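/- Let $R$ be any ring, let $B$ be a finite set of points on the circle $\partial D^2$, and let $\mathcal O,\mathcal O'$ be smoothings with boundary $B$, i.e. compact $1$-manifolds properly embedded in the disk $D^2$ with boundary $B$. A cobordism from $\mathcal O$ to $\mathcal O'$ is a compact (locally flat) surface properly embedded in the cylinder $D^2\times[0,1]$ with boundary $(\mathcal O\times\{1\})\cup(\mathcal O'\times\{0\})\cup(B\times[0,1])$. Let $M_R(\mathcal O,\mathcal O')$ be the free $R$-module on the set of cobordisms from $\mathcal O$ to $\mathcal O'$ modulo ambient isotopy of the cylinder fixing its boundary pointwise. Let $C$ be a cobordism that meets a (tame) closed ball in the interior of the cylinder in $n$ disjoint properly embedded disks $D_1,\dots,D_n$ (the "sites"), in standard position: all of them border one common region of the ball (they are boundary-parallel and unnested). The disks may lie on different components of $C$. For $i\ne j$ let $C_{ij}$ be the cobordism obtained from $C$ by removing $D_i$ and $D_j$ and replacing them, inside the ball and inside that common region, by an unknotted tube with the same boundary; let $H_i$ be the cobordism obtained from $C$ by adding an unknotted handle at $D_i$ inside the ball. Consider the following relations in $M_R(\mathcal O,\mathcal O')$, each imposed for all such $C$, balls and numberings of the sites: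 \begin{align*} 4Tu\ (n=4):&\quad C_{12}+C_{34}=C_{13}+C_{24},\\ 3S_1\ (n=3):&\quad C_{23}+H_1=C_{12}+C_{13},\\ 3S_2\ (n=3):&\quad C_{12}+C_{23}+C_{13}-H_1-H_2-H_3=0. \end{align*} Proposition. The relations $3S_1$ and $3S_2$ are equivalent to each other and to $4Tu$, over any ground ring: for all $R$, $B$, $\mathcal O$, $\mathcal O'$ as above, the $R$-submodules of $M_R(\mathcal O,\mathcal O')$ spanned by all instances of $3S_1$, of $3S_2$ and of $4Tu$ coincide. -/

import Mathlib

/-- The closed unit disk in the plane. -/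
abbrev Disk : Type := Metric.closedBall (0 : ℂ) 1

/-- The solid cylinder `Disk × [0,1]`; the second coordinate is the height. -/
abbrev Cylinder : Type := Disk × unitInterval

/-- The boundary of the solid cylinder: side, bottom and top. -/
def cylinderBoundary : Set Cylinder :=
  {p | ‖(p.1 : ℂ)‖ = 1 ∨ p.2 = 0 ∨ p.2 = 1}

/-- `S` is a closed, locally flat, properly embedded codimension-one submanifold of the
`(m + 2)`-dimensional topological manifold with boundary `X`: near each of its points the pair
`(X, S)` looks like a half-space (boundary `x₀ = 0`) together with the hyperplane on which the last
coordinate vanishes. Corners of `X` play no role for such topological charts. -/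
def IsProperHypersurface {X : Type} [TopologicalSpace X] (m : ℕ) (S : Set X) : Prop :=
  IsClosed S ∧ ∀ p ∈ S, ∃ e : OpenPartialHomeomorph X (EuclideanHalfSpace (m + 2)),
    p ∈ e.source ∧ ∀ q ∈ e.source, q ∈ S ↔ (e q).1 (Fin.last (m + 1)) = 0

/-- A smoothing with boundary `B`: a compact 1-manifold properly embedded in the disk that
meets the boundary circle exactly in the finite set `B`. -/
structure Smoothing (B : Finset Circle) where
  carrier : Set Disk
  proper : IsProperHypersurface 0 carrier
  boundary : ∀ p : Disk, ‖(p : ℂ)‖ = 1 → (p ∈ carrier ↔ ∃ b ∈ B, (b : ℂ) = (p : ℂ))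

/-- A cobordism from `O` to `O'`: a compact surface properly embedded in the cylinder whose top
boundary is `O`, whose bottom boundary is `O'`, and whose boundary on the side of the cylinder
consists of the vertical lines over `B`. -/
structure Cobordism {B : Finset Circle} (O O' : Smoothing B) where
  carrier : Set Cylinder
  proper : IsProperHypersurface 1 carrier
  top : ∀ p : Cylinder, p.2 = 1 → (p ∈ carrier ↔ p.1 ∈ O.carrier)
  bottom : ∀ p : Cylinder, p.2 = 0 → (p ∈ carrier ↔ p.1 ∈ O'.carrier)
  side : ∀ p : Cylinder, ‖(p.1 : ℂ)‖ = 1 → (p ∈ carrier ↔ ∃ b ∈ B, (b : ℂ) = (p.1 : ℂ))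

/-- Two subsets of the cylinder are isotopic relative to the boundary: some ambient isotopy
(a level-preserving homeomorphism of `[0,1] × Cylinder`, the first factor being time, which is the
identity at time `0`) that fixes the boundary of the cylinder pointwise carries one to the other. -/
def IsotopicRelBoundary (S S' : Set Cylinder) : Prop :=
  ∃ F : (unitInterval × Cylinder) ≃ₜ (unitInterval × Cylinder),
    (∀ x, (F x).1 = x.1) ∧ (∀ p, F (0, p) = (0, p)) ∧
    (∀ t, ∀ p ∈ cylinderBoundary, F (t, p) = (t, p)) ∧
    ∀ p, p ∈ S ↔ (F (1, p)).2 ∈ S'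

theorem IsotopicRelBoundary.refl (S : Set Cylinder) : IsotopicRelBoundary S S :=
  ⟨Homeomorph.refl _, fun _ => rfl, fun _ => rfl, fun _ _ _ => rfl, fun _ => Iff.rfl⟩

theorem IsotopicRelBoundary.symm {S S' : Set Cylinder} (h : IsotopicRelBoundary S S') :
    IsotopicRelBoundary S' S := by
  obtain ⟨F, h1, h2, h3, h4⟩ := h
  have h1' : ∀ x, (F.symm x).1 = x.1 := fun x => by
    rw [← h1 (F.symm x), F.apply_symm_apply]
  refine ⟨F.symm, h1', fun p => ?_, fun t p hp => ?_, fun p => ?_⟩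
  · rw [Homeomorph.symm_apply_eq, h2]
  · rw [Homeomorph.symm_apply_eq, h3 t p hp]
  · rw [h4]
    have : ((1 : unitInterval), (F.symm (1, p)).2) = F.symm (1, p) :=
      Prod.ext (h1' (1, p)).symm rfl
    rw [this, F.apply_symm_apply]

theorem IsotopicRelBoundary.trans {S S' S'' : Set Cylinder} (h : IsotopicRelBoundary S S')
    (h' : IsotopicRelBoundary S' S'') : IsotopicRelBoundary S S'' := by
  obtain ⟨F, h1, h2, h3, h4⟩ := h
  obtain ⟨G, g1, g2, g3, g4⟩ := h'
  refine ⟨F.trans G, fun x => ?_, fun p => ?_, fun t p hp => ?_, fun p => ?_⟩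
  · simp [g1, h1]
  · simp [h2, g2]
  · simp [h3 t p hp, g3 t p hp]
  · rw [h4, g4]
    have : ((1 : unitInterval), (F (1, p)).2) = F (1, p) := Prod.ext (h1 (1, p)).symm rfl
    rw [this, Homeomorph.trans_apply]

/-- Isotopy of cobordisms relative to the boundary, as an equivalence relation. -/
instance Cobordism.isotopySetoid {B : Finset Circle} (O O' : Smoothing B) :
    Setoid (Cobordism O O') where
  r C C' := IsotopicRelBoundary C.carrier C'.carrier
  iseqv := ⟨fun C => .refl C.carrier, fun h => h.symm, fun h h' => h.trans h'⟩

/-- Isotopy classes of cobordisms, i.e. the morphisms from `O` to `O'` before linearization. -/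
def CobordismClass {B : Finset Circle} (O O' : Smoothing B) : Type :=
  Quotient (Cobordism.isotopySetoid O O')

/-- Formal `R`-linear combinations of isotopy classes of cobordisms. -/
abbrev LinearCob (R : Type*) [Ring R] {B : Finset Circle} (O O' : Smoothing B) : Type _ :=
  CobordismClass O O' →₀ R

/-- The isotopy class of a cobordism as a generator of the free module. -/
noncomputable def Cobordism.toLinear (R : Type*) [Ring R] {B : Finset Circle} {O O' : Smoothing B}
    (C : Cobordism O O') : LinearCob R O O' :=
  Finsupp.single (Quotient.mk (Cobordism.isotopySetoid O O') C) 1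

/-! ### Local pictures

Each local picture is the part inside a closed box of the frontier of a solid `P × [-1,1]`, where
`P` is a planar region. The floor of the box is the face `y = 0`, and coordinates are
`((x, y), z)`. -/

/-- The closed 3-ball (a box) in which the local pictures with `n` sites live. -/
def box (n : ℕ) : Set ((ℝ × ℝ) × ℝ) :=
  {q | (-1 ≤ q.1.1 ∧ q.1.1 ≤ 2 * n) ∧ (0 ≤ q.1.2 ∧ q.1.2 ≤ 4) ∧ (-2 ≤ q.2 ∧ q.2 ≤ 2)}

/-- The planar profile of a solid finger that pokes through the floor at site number `k`. -/
def finger (k : ℕ) : Set (ℝ × ℝ) := {p | 2 * k ≤ p.1 ∧ p.1 ≤ 2 * k + 1 ∧ p.2 ≤ 1}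

/-- `n` disjoint fingers, standing in a row. -/
def fingers (n : ℕ) : Set (ℝ × ℝ) := {p | ∃ k < n, p ∈ finger k}

/-- For `i < j`, the planar profile of an arch that extends the fingers `i` and `j`, joins them,
and passes above all fingers between them. -/
def arch (i j : ℕ) : Set (ℝ × ℝ) :=
  {p | 2 * i ≤ p.1 ∧ p.1 ≤ 2 * j + 1 ∧ p.2 ≤ 3 ∧
    ¬ (2 * i + 1 < p.1 ∧ p.1 < 2 * j ∧ p.2 < 2)}

/-- The planar profile of a window inside finger `i`. -/
def window (i : ℕ) : Set (ℝ × ℝ) :=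
  {p | 2 * i + 1 / 4 < p.1 ∧ p.1 < 2 * i + 3 / 4 ∧ 1 / 4 < p.2 ∧ p.2 < 3 / 4}

/-- The surface that bounds the thickening of a planar region. -/
def thickSurface (P : Set (ℝ × ℝ)) : Set ((ℝ × ℝ) × ℝ) := frontier (P ×ˢ Set.Icc (-1) 1)

/-- In the box, one disk (the surface of a finger) at each of `n` sites. The disks are unnested:
all of them border the region of the box that lies outside the fingers. -/
def diskPicture (n : ℕ) : Set ((ℝ × ℝ) × ℝ) := thickSurface (fingers n)

/-- For `i < j`, the disks at sites `i` and `j` are replaced by an unknotted tube. -/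
def tubePicture (n i j : ℕ) : Set ((ℝ × ℝ) × ℝ) := thickSurface (fingers n ∪ arch i j)

/-- A handle is added to the disk at site `i`: a tunnel is drilled straight through the finger,
so that the disk becomes a once-punctured unknotted torus. -/
def handlePicture (n i : ℕ) : Set ((ℝ × ℝ) × ℝ) := thickSurface (fingers n \ window i)

/-- A coordinate chart in the interior of the cylinder. -/
def IsInteriorChart (φ : (ℝ × ℝ) × ℝ → Cylinder) : Prop :=
  Topology.IsOpenEmbedding φ ∧ ∀ x, φ x ∉ cylinderBoundary

/-- The cobordism `C` meets the ball `φ(box n)` in `n` standard disks. -/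
def Cobordism.HasDisks {B : Finset Circle} {O O' : Smoothing B} (C : Cobordism O O')
    (φ : (ℝ × ℝ) × ℝ → Cylinder) (n : ℕ) : Prop :=
  IsInteriorChart φ ∧ C.carrier ∩ φ '' box n = φ '' (box n ∩ diskPicture n)

/-- `C'` is obtained from `C` by replacing its part in the ball `φ(box n)` by the image of the
local picture `M`. -/
def Cobordism.IsReplacement {B : Finset Circle} {O O' : Smoothing B} (C : Cobordism O O')
    (φ : (ℝ × ℝ) × ℝ → Cylinder) (n : ℕ) (M : Set ((ℝ × ℝ) × ℝ)) (C' : Cobordism O O') : Prop :=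
  C'.carrier = (C.carrier \ φ '' box n) ∪ φ '' (box n ∩ M)

/-- `C'` is the result of tubing the disks at the sites `i < j` of `C`. -/
def Cobordism.IsTubing {B : Finset Circle} {O O' : Smoothing B} (C : Cobordism O O')
    (φ : (ℝ × ℝ) × ℝ → Cylinder) (n i j : ℕ) (C' : Cobordism O O') : Prop :=
  C.IsReplacement φ n (tubePicture n i j) C'

/-- `C'` is the result of adding a handle to `C` at the site `i`. -/
def Cobordism.IsHandling {B : Finset Circle} {O O' : Smoothing B} (C : Cobordism O O')
    (φ : (ℝ × ℝ) × ℝ → Cylinder) (n i : ℕ) (C' : Cobordism O O') : Prop :=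
  C.IsReplacement φ n (handlePicture n i) C'

/-- All instances of the four-tube relation `C₁₂ + C₃₄ = C₁₃ + C₂₄`, written as elements that are
set to zero (sites are numbered from `0`). -/
def fourTube (R : Type*) [Ring R] {B : Finset Circle} (O O' : Smoothing B) :
    Set (LinearCob R O O') :=
  {v | ∃ (φ : (ℝ × ℝ) × ℝ → Cylinder) (C C12 C34 C13 C24 : Cobordism O O'),
    C.HasDisks φ 4 ∧ C.IsTubing φ 4 0 1 C12 ∧ C.IsTubing φ 4 2 3 C34 ∧
    C.IsTubing φ 4 0 2 C13 ∧ C.IsTubing φ 4 1 3 C24 ∧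
    v = C12.toLinear R + C34.toLinear R - (C13.toLinear R + C24.toLinear R)}

/-- All instances of the first three-site relation `C₂₃ + H₁ = C₁₂ + C₁₃`; the two upper sites of
the usual picture are `2` and `3`, the lower one is `1`. -/
def threeSite₁ (R : Type*) [Ring R] {B : Finset Circle} (O O' : Smoothing B) :
    Set (LinearCob R O O') :=
  {v | ∃ (φ : (ℝ × ℝ) × ℝ → Cylinder) (C C23 H1 C12 C13 : Cobordism O O'),
    C.HasDisks φ 3 ∧ C.IsTubing φ 3 1 2 C23 ∧ C.IsHandling φ 3 0 H1 ∧
    C.IsTubing φ 3 0 1 C12 ∧ C.IsTubing φ 3 0 2 C13 ∧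
    v = C23.toLinear R + H1.toLinear R - (C12.toLinear R + C13.toLinear R)}

/-- All instances of the second three-site relation `C₁₂ + C₂₃ + C₁₃ - H₁ - H₂ - H₃ = 0`. -/
def threeSite₂ (R : Type*) [Ring R] {B : Finset Circle} (O O' : Smoothing B) :
    Set (LinearCob R O O') :=
  {v | ∃ (φ : (ℝ × ℝ) × ℝ → Cylinder) (C C12 C23 C13 H1 H2 H3 : Cobordism O O'),
    C.HasDisks φ 3 ∧ C.IsTubing φ 3 0 1 C12 ∧ C.IsTubing φ 3 1 2 C23 ∧ C.IsTubing φ 3 0 2 C13 ∧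
    C.IsHandling φ 3 0 H1 ∧ C.IsHandling φ 3 1 H2 ∧ C.IsHandling φ 3 2 H3 ∧
    v = C12.toLinear R + C23.toLinear R + C13.toLinear R
      - (H1.toLinear R + H2.toLinear R + H3.toLinear R)}

open Topology

/-! ### Extending homeomorphisms and the Alexander trick -/

/-! The algebra is short; write T for tubes and H for handles, with sites numbered from 0. Two
instances of 3S₁ inside a ball with four sites, at the triples (0;2,3) and (0;1,3), share the terms
H0 and T03. Their difference is 4Tu. Conversely, regard one disk as two parallel sites, connected
outside a smaller ball. A tube between the two halves is then a handle on the original disk, and a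
tube or handle at either half is the tube or handle at the original site. Splitting the
distinguished site of a 3S₁ instance in this way exhibits it as an instance of 4Tu. Splitting one of
two sites turns both 3S₁ and 3S₂ into the neck-cutting relation 2T01 = H0 + H1. At three sites the
sum of the 3S₁ and 3S₂ expressions is 2T12 - H1 - H2, a neck-cutting expression, so each relation
follows from the other. Nothing is divided by 2, hence the ground ring is arbitrary.

The topology has to justify these changes of viewpoint. All pictures are surfaces of thickened
planar regions, so it suffices to work with homeomorphisms of the plane. One supported in the planar
box is tapered off in the third direction, extended by the identity to the cylinder, and joined to
the identity by the Alexander trick; so `Deforms` implies equality of classes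
(`Cobordism.IsReplacement.exists_of_deforms`). A planar change of coordinates that embeds a smaller
box (`IsSubbox`, `RestrictsTo`) leaves the cobordisms alone and reinterprets them in the new chart.
The split itself is `exists_split`, packaged in `Cobordism.HasDisks.exists_split`.

An instance of one relation need not contain all cobordisms that another one mentions. The missing
ones are built by replacement, and their local flatness, in particular along the edges of the
pictures, is borrowed from tubes already present (`Cobordism.HasDisks.exists_isHandling`,
`Cobordism.HasDisks.exists_isTubing_zero_three`). -/

theorem Topology.IsOpenEmbedding.continuous_extend {A B : Type*} [TopologicalSpace A]
    [TopologicalSpace B] [T2Space B] {j : A → B} (hj : IsOpenEmbedding j) {f : A → A}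
    (hf : Continuous f) {K : Set A} (hK : IsCompact K) (hfK : ∀ a ∉ K, f a = a) :
    Continuous (Function.extend j (j ∘ f) id) := by
  rw [continuous_iff_continuousAt]
  intro b
  by_cases hb : ∃ a, j a = b
  · obtain ⟨a, rfl⟩ := hb
    rw [← hj.continuousAt_iff]
    have : Function.extend j (j ∘ f) id ∘ j = j ∘ f := by
      funext x
      exact hj.injective.extend_apply _ _ _
    rw [this]
    exact (hj.continuous.comp hf).continuousAt
  · have hopen : (j '' K)ᶜ ∈ 𝓝 b :=
      (hK.image hj.continuous).isClosed.isOpen_compl.mem_nhds fun ⟨a, _, h⟩ => hb ⟨a, h⟩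
    refine continuousAt_id.congr ?_
    filter_upwards [hopen] with c hc
    by_cases h : ∃ a, j a = c
    · obtain ⟨a, rfl⟩ := h
      rw [hj.injective.extend_apply, Function.comp_apply,
        hfK a fun ha => hc (Set.mem_image_of_mem _ ha)]
      rfl
    · rw [Function.extend_apply' _ _ _ h]

/-- A homeomorphism that is the identity off a compact set extends along an open embedding. -/
theorem Topology.IsOpenEmbedding.exists_homeomorph_extend {A B : Type*} [TopologicalSpace A]
    [TopologicalSpace B] [T2Space B] {j : A → B} (hj : IsOpenEmbedding j) (f : A ≃ₜ A)
    {K : Set A} (hK : IsCompact K) (hfK : ∀ a ∉ K, f a = a) :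
    ∃ g : B ≃ₜ B, (∀ a, g (j a) = j (f a)) ∧ ∀ b ∉ j '' K, g b = b := by
  have hfK' : ∀ a ∉ K, f.symm a = a := fun a ha => by
    rw [Homeomorph.symm_apply_eq, hfK a ha]
  have key : ∀ f₁ f₂ : A → A, (∀ a, f₂ (f₁ a) = a) → ∀ b,
      Function.extend j (j ∘ f₂) id (Function.extend j (j ∘ f₁) id b) = b := by
    intro f₁ f₂ h b
    by_cases hb : ∃ a, j a = b
    · obtain ⟨a, rfl⟩ := hb
      simp [hj.injective.extend_apply, h]
    · simp [Function.extend_apply' _ _ _ hb]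
  refine ⟨⟨⟨Function.extend j (j ∘ f) id, Function.extend j (j ∘ f.symm) id,
    key _ _ f.symm_apply_apply, key _ _ f.apply_symm_apply⟩,
    hj.continuous_extend f.continuous hK hfK, hj.continuous_extend f.symm.continuous hK hfK'⟩,
    fun a => hj.injective.extend_apply _ _ _, fun b hb => ?_⟩
  change Function.extend j (j ∘ f) id b = b
  by_cases h : ∃ a, j a = b
  · obtain ⟨a, rfl⟩ := h
    rw [hj.injective.extend_apply, Function.comp_apply,
      hfK a fun ha => hb (Set.mem_image_of_mem _ ha)]
  · rw [Function.extend_apply' _ _ _ h, id]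

theorem exists_norm_sub_le_of_eq_off_compact {V : Type*}
    [NormedAddCommGroup V] {h : V ≃ₜ V} {K : Set V} (hK : IsCompact K)
    (hh : ∀ p ∉ K, h p = p) : ∃ M : ℝ, ∀ p, ‖h p - p‖ ≤ M := by
  obtain ⟨M, hM⟩ := hK.exists_bound_of_continuousOn
    (f := fun p => h p - p) (h.continuous.sub continuous_id).continuousOn
  refine ⟨max M 0, fun p => ?_⟩
  by_cases hp : p ∈ K
  · exact (hM p hp).trans (le_max_left _ _)
  · simp [hh p hp]

section Alexander

variable {V : Type*} [NormedAddCommGroup V] [NormedSpace ℝ V]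

/-- For s ≠ 0 the map is the conjugate p ↦ s • h(s⁻¹ • p), written as a displacement so that it also
makes sense at s = 0. Continuity there holds because the displacement has norm at most |s| M. -/
theorem continuous_alexander {h : V → V} (hh : Continuous h) {M : ℝ} (hM : ∀ p, ‖h p - p‖ ≤ M) :
    Continuous fun x : ℝ × V => x.2 + x.1 • (h (x.1⁻¹ • x.2) - x.1⁻¹ • x.2) := by
  refine continuous_snd.add ?_
  rw [continuous_iff_continuousAt]
  rintro ⟨s, p⟩
  by_cases hs : s = 0
  · subst hs
    rw [ContinuousAt, zero_smul, tendsto_zero_iff_norm_tendsto_zero]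
    have h1 : Filter.Tendsto (fun x : ℝ × V => |x.1| * M) (𝓝 (0, p)) (𝓝 0) := by
      have : Continuous fun x : ℝ × V => |x.1| * M := by fun_prop
      simpa using this.tendsto (0, p)
    refine squeeze_zero (fun _ => norm_nonneg _) (fun x => ?_) h1
    rw [norm_smul, Real.norm_eq_abs]
    exact mul_le_mul_of_nonneg_left (hM _) (abs_nonneg _)
  · have h1 : ContinuousAt (fun x : ℝ × V => x.1⁻¹ • x.2) (s, p) :=
      (continuousAt_fst.inv₀ hs).smul continuousAt_snd
    exact continuousAt_fst.smul ((hh.continuousAt.comp h1).sub h1)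

/-- The Alexander isotopy from the identity (at time `0`) to `h` (at time `1`). -/
noncomputable def alexander (h : V ≃ₜ V) {M : ℝ} (hM : ∀ p, ‖h p - p‖ ≤ M) :
    (ℝ × V) ≃ₜ (ℝ × V) where
  toFun x := (x.1, x.2 + x.1 • (h (x.1⁻¹ • x.2) - x.1⁻¹ • x.2))
  invFun x := (x.1, x.2 + x.1 • (h.symm (x.1⁻¹ • x.2) - x.1⁻¹ • x.2))
  left_inv := by
    rintro ⟨s, p⟩
    by_cases hs : s = 0
    · simp [hs]
    · have : s⁻¹ • (p + s • (h (s⁻¹ • p) - s⁻¹ • p)) = h (s⁻¹ • p) := by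
        rw [smul_add, inv_smul_smul₀ hs]; abel
      simp only [this, h.symm_apply_apply, Prod.mk.injEq, true_and]
      rw [add_assoc, ← smul_add]
      simp
  right_inv := by
    rintro ⟨s, p⟩
    by_cases hs : s = 0
    · simp [hs]
    · have : s⁻¹ • (p + s • (h.symm (s⁻¹ • p) - s⁻¹ • p)) = h.symm (s⁻¹ • p) := by
        rw [smul_add, inv_smul_smul₀ hs]; abel
      simp only [this, h.apply_symm_apply, Prod.mk.injEq, true_and]
      rw [add_assoc, ← smul_add]
      simp
  continuous_toFun := continuous_fst.prodMk (continuous_alexander h.continuous hM)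
  continuous_invFun := continuous_fst.prodMk (continuous_alexander (M := M) h.symm.continuous
    fun p => by simpa [norm_sub_rev] using hM (h.symm p))

theorem alexander_zero (h : V ≃ₜ V) {M : ℝ} (hM : ∀ p, ‖h p - p‖ ≤ M) (p : V) :
    alexander h hM (0, p) = (0, p) := by
  simp [alexander]

theorem alexander_one (h : V ≃ₜ V) {M : ℝ} (hM : ∀ p, ‖h p - p‖ ≤ M) (p : V) :
    alexander h hM (1, p) = (1, h p) := by
  simp [alexander]

/-- The isotopy never leaves the support: at time s only s • K moves, and this lies in K since K is
star-shaped about 0 and s ≤ 1. -/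
theorem alexander_eq_self (h : V ≃ₜ V) {M : ℝ} (hM : ∀ p, ‖h p - p‖ ≤ M) {K : Set V}
    (hK : StarConvex ℝ 0 K) (hh : ∀ p ∉ K, h p = p) {s : ℝ} (h0 : 0 ≤ s) (h1 : s ≤ 1) {p : V}
    (hp : p ∉ K) : alexander h hM (s, p) = (s, p) := by
  rcases h0.eq_or_lt with rfl | h0
  · exact alexander_zero h hM p
  · have : s⁻¹ • p ∉ K := fun hq => hp <| by
      have := hK hq (a := 1 - s) (b := s) (by linarith) h0.le (by ring)
      simpa [h0.ne'] using this
    simp [alexander, hh _ this]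

end Alexander

/-- A homeomorphism of a chart supported in a compact set that is star-shaped about the origin
moves sets only within their isotopy class. -/
theorem isotopicRelBoundary_of_homeomorph {φ : (ℝ × ℝ) × ℝ → Cylinder} (hφ : IsInteriorChart φ)
    {K : Set ((ℝ × ℝ) × ℝ)} (hK : IsCompact K) (hK' : StarConvex ℝ 0 K)
    (h : ((ℝ × ℝ) × ℝ) ≃ₜ ((ℝ × ℝ) × ℝ)) (hh : ∀ p ∉ K, h p = p) {S S' : Set Cylinder}
    (hS : ∀ p, φ p ∈ S ↔ φ (h p) ∈ S') (hS' : ∀ q ∉ φ '' K, q ∈ S ↔ q ∈ S') :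
    IsotopicRelBoundary S S' := by
  obtain ⟨M, hM⟩ := exists_norm_sub_le_of_eq_off_compact hK hh
  set F : (unitInterval × ((ℝ × ℝ) × ℝ)) ≃ₜ (unitInterval × ((ℝ × ℝ) × ℝ)) :=
    { toFun := fun x => (x.1, (alexander h hM (x.1, x.2)).2)
      invFun := fun x => (x.1, ((alexander h hM).symm (x.1, x.2)).2)
      left_inv := fun x => by
        have : (((x.1 : ℝ)), (alexander h hM (x.1, x.2)).2) = alexander h hM (x.1, x.2) := rfl
        simp only [this, Homeomorph.symm_apply_apply]
      right_inv := fun x => by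
        have : (((x.1 : ℝ)), ((alexander h hM).symm (x.1, x.2)).2)
          = (alexander h hM).symm (x.1, x.2) := rfl
        simp only [this, Homeomorph.apply_symm_apply]
      continuous_toFun := continuous_fst.prodMk (continuous_snd.comp
        ((alexander h hM).continuous.comp
          ((continuous_subtype_val.comp continuous_fst).prodMk continuous_snd)))
      continuous_invFun := continuous_fst.prodMk (continuous_snd.comp
        ((alexander h hM).symm.continuous.comp
          ((continuous_subtype_val.comp continuous_fst).prodMk continuous_snd))) } with hF
  have hFK : ∀ x ∉ (Set.univ : Set unitInterval) ×ˢ K, F x = x := by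
    rintro ⟨s, p⟩ hx
    have hp : p ∉ K := fun hp => hx ⟨trivial, hp⟩
    have := alexander_eq_self h hM hK' hh s.2.1 s.2.2 hp
    simp [hF, this]
  -- The isotopy is extended over all times at once, along id × φ, which gives joint continuity. Its
  -- support lies in [0,1] × K, so the boundary, which the chart avoids, stays fixed.
  have hj : IsOpenEmbedding (Prod.map (id : unitInterval → unitInterval) φ) :=
    IsOpenEmbedding.id.prodMap hφ.1
  obtain ⟨G, hG, hG'⟩ := hj.exists_homeomorph_extend F (isCompact_univ.prod hK) hFK
  have hG1 : ∀ s p, G (s, φ p) = (s, φ (alexander h hM (s, p)).2) := fun s p => hG (s, p)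
  have hG2 : ∀ s, ∀ q ∉ φ '' K, G (s, q) = (s, q) := by
    intro s q hq
    refine hG' _ ?_
    rintro ⟨⟨s', p⟩, ⟨-, hp⟩, he⟩
    exact hq ⟨p, hp, congrArg Prod.snd he⟩
  refine ⟨G, ?_, ?_, ?_, ?_⟩
  · rintro ⟨s, q⟩
    by_cases hq : q ∈ φ '' K
    · obtain ⟨p, -, rfl⟩ := hq
      rw [hG1]
    · rw [hG2 s q hq]
  · intro q
    by_cases hq : q ∈ φ '' K
    · obtain ⟨p, -, rfl⟩ := hq
      rw [hG1]
      have := alexander_zero h hM p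
      simp [this]
    · rw [hG2 _ q hq]
  · intro t q hq
    refine hG2 t q ?_
    rintro ⟨p, -, rfl⟩
    exact hφ.2 p hq
  · intro q
    by_cases hq : q ∈ φ '' K
    · obtain ⟨p, -, rfl⟩ := hq
      rw [hG1, hS]
      have := alexander_one h hM p
      simp [this]
    · rw [hG2 _ q hq, hS' q hq]

/-! ### Local flatness at a point -/

/-- Near `p`, the set `S` is empty or a locally flat proper hypersurface. -/
def FlatAt {X : Type} [TopologicalSpace X] (m : ℕ) (S : Set X) (p : X) : Prop :=
  Sᶜ ∈ 𝓝 p ∨ ∃ e : OpenPartialHomeomorph X (EuclideanHalfSpace (m + 2)),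
    p ∈ e.source ∧ ∀ q ∈ e.source, q ∈ S ↔ (e q).1 (Fin.last (m + 1)) = 0

/-- Closedness becomes a pointwise condition too: in a flat chart the complement is where a
continuous coordinate is nonzero, which is open. Properness can then be checked locally when
surfaces are cut and pasted. -/
theorem isProperHypersurface_iff_flatAt {X : Type} [TopologicalSpace X] {m : ℕ} {S : Set X} :
    IsProperHypersurface m S ↔ ∀ p, FlatAt m S p := by
  constructor
  · rintro ⟨h1, h2⟩ p
    by_cases hp : p ∈ S
    · exact Or.inr (h2 p hp)
    · exact Or.inl (h1.isOpen_compl.mem_nhds hp)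
  · intro h
    refine ⟨?_, fun p hp => ?_⟩
    · rw [← isOpen_compl_iff, isOpen_iff_mem_nhds]
      intro p hp
      rcases h p with h | ⟨e, hpe, he⟩
      · exact h
      · have hc : Continuous fun x : EuclideanHalfSpace (m + 2) => x.1 (Fin.last (m + 1)) := by
          fun_prop
        have hne : (e p).1 (Fin.last (m + 1)) ≠ 0 := fun h0 => hp ((he p hpe).2 h0)
        have h1 := (hc.continuousAt.comp (e.continuousAt hpe)).eventually_ne hne
        filter_upwards [h1, e.open_source.mem_nhds hpe] with q hq hqe hqS
        exact hq ((he q hqe).1 hqS)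
    · rcases h p with h | h
      · exact absurd hp (mem_of_mem_nhds h)
      · exact h

theorem FlatAt.congr {X : Type} [TopologicalSpace X] {m : ℕ} {S S' : Set X} {p : X}
    (h : FlatAt m S p) (hS : ∀ᶠ q in 𝓝 p, q ∈ S ↔ q ∈ S') : FlatAt m S' p := by
  rcases h with h | ⟨e, hpe, he⟩
  · left
    filter_upwards [h, hS] with q h1 h2 h3
    exact h1 (h2.2 h3)
  · right
    obtain ⟨U, hU, hUo, hpU⟩ := eventually_nhds_iff.1 hS
    refine ⟨e.restrOpen U hUo, ⟨hpe, hpU⟩, fun q hq => ?_⟩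
    rw [← hU q hq.2]
    exact he q hq.1

/-- Flat charts are transported by composition with the open embedding or its local inverse. This
moves flatness between a coordinate chart and the cylinder. -/
theorem flatAt_preimage_iff {A X : Type} [TopologicalSpace A] [TopologicalSpace X] {m : ℕ}
    {j : A → X} (hj : IsOpenEmbedding j) {S : Set X} {a : A} :
    FlatAt m (j ⁻¹' S) a ↔ FlatAt m S (j a) := by
  have : Nonempty A := ⟨a⟩
  have hinv : ∀ x, (hj.toOpenPartialHomeomorph j).symm (j x) = x :=
    fun x => hj.toOpenPartialHomeomorph_left_inv (f := j)
  constructor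
  · rintro (h | ⟨e, hpe, he⟩)
    · left
      rw [← hj.map_nhds_eq]
      exact h
    · right
      refine ⟨(hj.toOpenPartialHomeomorph j).symm.trans e, ?_, ?_⟩
      · simp [hinv, hpe]
      · rintro q hq
        simp only [OpenPartialHomeomorph.trans_source, OpenPartialHomeomorph.symm_source,
          IsOpenEmbedding.toOpenPartialHomeomorph_target, Set.mem_inter_iff, Set.mem_range,
          Set.mem_preimage] at hq
        obtain ⟨⟨b, rfl⟩, hb⟩ := hq
        rw [hinv] at hb
        simp only [OpenPartialHomeomorph.coe_trans, Function.comp_apply, hinv]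
        exact he b hb
  · rintro (h | ⟨e, hpe, he⟩)
    · left
      exact hj.continuous.continuousAt h
    · right
      refine ⟨(hj.toOpenPartialHomeomorph j).trans e, ?_, ?_⟩
      · simp [hpe]
      · intro q hq
        simp only [OpenPartialHomeomorph.trans_source,
          IsOpenEmbedding.toOpenPartialHomeomorph_source, Set.univ_inter, Set.mem_preimage,
          IsOpenEmbedding.toOpenPartialHomeomorph_apply] at hq
        exact he _ hq

theorem IsProperHypersurface.preimage_homeomorph {X : Type} [TopologicalSpace X] {m : ℕ}
    {S : Set X} (h : IsProperHypersurface m S) (g : X ≃ₜ X) :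
    IsProperHypersurface m (g ⁻¹' S) := by
  rw [isProperHypersurface_iff_flatAt] at h ⊢
  exact fun p => (flatAt_preimage_iff g.isOpenEmbedding).2 (h _)

/-! ### Thickened planar regions -/

/-- The planar profile of `box n`. -/
def planarBox (n : ℕ) : Set (ℝ × ℝ) := {p | (-1 ≤ p.1 ∧ p.1 ≤ 2 * n) ∧ 0 ≤ p.2 ∧ p.2 ≤ 4}

/-- The interior of `planarBox n`. -/
def openPlanarBox (n : ℕ) : Set (ℝ × ℝ) := {p | (-1 < p.1 ∧ p.1 < 2 * n) ∧ 0 < p.2 ∧ p.2 < 4}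

theorem mem_planarBox {n : ℕ} {p : ℝ × ℝ} :
    p ∈ planarBox n ↔ (-1 ≤ p.1 ∧ p.1 ≤ 2 * n) ∧ 0 ≤ p.2 ∧ p.2 ≤ 4 := Iff.rfl

theorem mem_box {n : ℕ} {q : (ℝ × ℝ) × ℝ} :
    q ∈ box n ↔ q.1 ∈ planarBox n ∧ -2 ≤ q.2 ∧ q.2 ≤ 2 := by
  simp [box, planarBox, and_assoc]

theorem planarBox_eq (n : ℕ) : planarBox n = Set.Icc (-1) (2 * (n : ℝ)) ×ˢ Set.Icc 0 4 := by
  ext p; simp only [planarBox, Set.mem_ofPred_eq, Set.mem_prod, Set.mem_Icc]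

theorem box_eq (n : ℕ) : box n = planarBox n ×ˢ Set.Icc (-2) 2 := by
  ext p; simp [mem_box]

theorem isCompact_planarBox (n : ℕ) : IsCompact (planarBox n) := by
  rw [planarBox_eq]; exact isCompact_Icc.prod isCompact_Icc

theorem isCompact_box (n : ℕ) : IsCompact (box n) := by
  rw [box_eq]; exact (isCompact_planarBox n).prod isCompact_Icc

theorem convex_planarBox (n : ℕ) : Convex ℝ (planarBox n) := by
  rw [planarBox_eq]; exact (convex_Icc _ _).prod (convex_Icc _ _)

theorem starConvex_planarBox (n : ℕ) : StarConvex ℝ 0 (planarBox n) :=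
  (convex_planarBox n).starConvex (by simp [planarBox])

theorem starConvex_box (n : ℕ) : StarConvex ℝ 0 (box n) := by
  refine Convex.starConvex ?_ (by simp [box])
  rw [box_eq]
  exact (convex_planarBox n).prod (convex_Icc _ _)

theorem isOpen_openPlanarBox (n : ℕ) : IsOpen (openPlanarBox n) := by
  have : openPlanarBox n = Set.Ioo (-1) (2 * (n : ℝ)) ×ˢ Set.Ioo 0 4 := by
    ext p; simp only [openPlanarBox, Set.mem_ofPred_eq, Set.mem_prod, Set.mem_Ioo]
  rw [this]; exact isOpen_Ioo.prod isOpen_Ioo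

theorem openPlanarBox_subset (n : ℕ) : openPlanarBox n ⊆ planarBox n :=
  fun _ hp => ⟨⟨hp.1.1.le, hp.1.2.le⟩, hp.2.1.le, hp.2.2.le⟩

theorem Filter.Eventually.mem_frontier_iff {X : Type*} [TopologicalSpace X] {S T : Set X} {x : X}
    (h : ∀ᶠ y in 𝓝 x, y ∈ S ↔ y ∈ T) : ∀ᶠ y in 𝓝 x, y ∈ frontier S ↔ y ∈ frontier T := by
  filter_upwards [h.eventually_nhds] with y hy
  have hy' : ∀ᶠ z in 𝓝 y, z ∈ Sᶜ ↔ z ∈ Tᶜ := by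
    filter_upwards [hy] with z hz
    simp [hz]
  rw [frontier_eq_closure_inter_closure, frontier_eq_closure_inter_closure, Set.mem_inter_iff,
    Set.mem_inter_iff, mem_closure_iff_frequently, mem_closure_iff_frequently,
    mem_closure_iff_frequently, mem_closure_iff_frequently, Filter.frequently_congr hy,
    Filter.frequently_congr hy']

/-- The frontier is a local notion, so planar agreement near p gives agreement of the surfaces over
all heights near p. -/
theorem eventually_mem_thickSurface_iff {P P' : Set (ℝ × ℝ)} {p : ℝ × ℝ}
    (h : ∀ᶠ q in 𝓝 p, q ∈ P ↔ q ∈ P') (z : ℝ) :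
    ∀ᶠ x in 𝓝 (p, z), x ∈ thickSurface P ↔ x ∈ thickSurface P' := by
  refine Filter.Eventually.mem_frontier_iff ?_
  filter_upwards [continuousAt_fst.eventually h] with x hx
  simp [Set.mem_prod, hx]

theorem mem_thickSurface_iff_of_eventually {P P' : Set (ℝ × ℝ)} {p : ℝ × ℝ}
    (h : ∀ᶠ q in 𝓝 p, q ∈ P ↔ q ∈ P') (z : ℝ) :
    (p, z) ∈ thickSurface P ↔ (p, z) ∈ thickSurface P' :=
  (eventually_mem_thickSurface_iff h z).self_of_nhds

theorem mem_thickSurface_homeomorph (ψ : (ℝ × ℝ) ≃ₜ (ℝ × ℝ)) (P : Set (ℝ × ℝ)) (p : ℝ × ℝ)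
    (z : ℝ) : (ψ p, z) ∈ thickSurface P ↔ (p, z) ∈ thickSurface (ψ ⁻¹' P) := by
  have := (ψ.prodCongr (Homeomorph.refl ℝ)).preimage_frontier (P ×ˢ Set.Icc (-1) 1)
  change (p, z) ∈ (ψ.prodCongr (Homeomorph.refl ℝ)) ⁻¹' frontier (P ×ˢ Set.Icc (-1) 1) ↔ _
  rw [this]
  rfl

theorem thickSurface_subset (P : Set (ℝ × ℝ)) :
    thickSurface P ⊆ {x | x.2 ∈ Set.Icc (-1 : ℝ) 1} := by
  refine frontier_subset_closure.trans (closure_minimal (fun x hx => hx.2) ?_)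
  exact isClosed_Icc.preimage continuous_snd

theorem eventually_notMem_thickSurface (P : Set (ℝ × ℝ)) {p : ℝ × ℝ} {z : ℝ}
    (hz : z ∉ Set.Icc (-1 : ℝ) 1) : ∀ᶠ x in 𝓝 (p, z), x ∉ thickSurface P := by
  have : ∀ᶠ x : (ℝ × ℝ) × ℝ in 𝓝 (p, z), x.2 ∉ Set.Icc (-1 : ℝ) 1 :=
    (isClosed_Icc.isOpen_compl.preimage continuous_snd).mem_nhds hz
  filter_upwards [this] with x hx h
  exact hx (thickSurface_subset P h)

/-- Planar regions that differ by a homeomorphism of the plane supported in `planarBox n`. -/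
def Deforms (n : ℕ) (P P' : Set (ℝ × ℝ)) : Prop :=
  ∃ h : (ℝ × ℝ) ≃ₜ (ℝ × ℝ), (∀ p ∉ planarBox n, h p = p) ∧ ∀ p, h p ∈ P' ↔ p ∈ P

theorem Deforms.symm {n : ℕ} {P P' : Set (ℝ × ℝ)} (h : Deforms n P P') : Deforms n P' P := by
  obtain ⟨h, h1, h2⟩ := h
  refine ⟨h.symm, fun p hp => ?_, fun p => ?_⟩
  · rw [Homeomorph.symm_apply_eq, h1 p hp]
  · rw [← h2, h.apply_symm_apply]

theorem Deforms.trans {n : ℕ} {P P' P'' : Set (ℝ × ℝ)} (h : Deforms n P P')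
    (h' : Deforms n P' P'') : Deforms n P P'' := by
  obtain ⟨h, h1, h2⟩ := h
  obtain ⟨g, g1, g2⟩ := h'
  refine ⟨h.trans g, fun p hp => ?_, fun p => ?_⟩
  · simp [h1 p hp, g1 p hp]
  · simp [h2, g2]

/-- A homeomorphism of the plane supported in `planarBox n` extends to a homeomorphism of space
supported in `box n`. -/
theorem Deforms.exists_homeomorph {n : ℕ} {P P' : Set (ℝ × ℝ)} (h : Deforms n P P') :
    ∃ H : ((ℝ × ℝ) × ℝ) ≃ₜ ((ℝ × ℝ) × ℝ), (∀ x ∉ box n, H x = x) ∧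
      ∀ x, H x ∈ thickSurface P' ↔ x ∈ thickSurface P := by
  obtain ⟨h, h1, h2⟩ := h
  obtain ⟨M, hM⟩ := exists_norm_sub_le_of_eq_off_compact (isCompact_planarBox n) h1
  -- The height serves as Alexander time: the slice at z is moved by the isotopy at time ρ z. This
  -- is all of h for |z| ≤ 1, where the thickening lives, and the identity for |z| ≥ 2, at the ends
  -- of the box.
  set ρ : ℝ → ℝ := fun z => max 0 (min 1 (2 - |z|)) with hρ
  have hρc : Continuous ρ := by fun_prop
  have hρ0 : ∀ z, 0 ≤ ρ z := fun z => le_max_left _ _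
  have hρ1 : ∀ z, ρ z ≤ 1 := fun z => max_le zero_le_one (min_le_left _ _)
  set H : ((ℝ × ℝ) × ℝ) ≃ₜ ((ℝ × ℝ) × ℝ) :=
    { toFun := fun x => ((alexander h hM (ρ x.2, x.1)).2, x.2)
      invFun := fun x => (((alexander h hM).symm (ρ x.2, x.1)).2, x.2)
      left_inv := fun x => by
        have : (ρ x.2, (alexander h hM (ρ x.2, x.1)).2) = alexander h hM (ρ x.2, x.1) := rfl
        simp only [this, Homeomorph.symm_apply_apply]
      right_inv := fun x => by
        have : (ρ x.2, ((alexander h hM).symm (ρ x.2, x.1)).2)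
          = (alexander h hM).symm (ρ x.2, x.1) := rfl
        simp only [this, Homeomorph.apply_symm_apply]
      continuous_toFun := (continuous_snd.comp ((alexander h hM).continuous.comp
        ((hρc.comp continuous_snd).prodMk continuous_fst))).prodMk continuous_snd
      continuous_invFun := (continuous_snd.comp ((alexander h hM).symm.continuous.comp
        ((hρc.comp continuous_snd).prodMk continuous_fst))).prodMk continuous_snd } with hH
  refine ⟨H, ?_, ?_⟩
  · rintro ⟨p, z⟩ hx
    change ((alexander h hM (ρ z, p)).2, z) = (p, z)
    by_cases hp : p ∈ planarBox n
    · have hz : ρ z = 0 := by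
        have : 2 < |z| := by
          by_contra hz
          exact hx (mem_box.2 ⟨hp, abs_le.1 (not_lt.1 hz)⟩)
        exact max_eq_left ((min_le_right _ _).trans (by linarith))
      rw [hz, alexander_zero]
    · rw [alexander_eq_self h hM (starConvex_planarBox n) h1 (hρ0 z) (hρ1 z) hp]
  · have key : H ⁻¹' (P' ×ˢ Set.Icc (-1) 1) = P ×ˢ Set.Icc (-1) 1 := by
      ext ⟨p, z⟩
      change ((alexander h hM (ρ z, p)).2, z) ∈ P' ×ˢ Set.Icc (-1 : ℝ) 1 ↔ _
      simp only [Set.mem_prod]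
      refine and_congr_left fun hz => ?_
      have hz : ρ z = 1 := by
        have : |z| ≤ 1 := abs_le.2 hz
        simp only [hρ]
        rw [min_eq_left (by linarith), max_eq_right zero_le_one]
      rw [hz, alexander_one, h2]
    intro x
    rw [thickSurface, thickSurface, ← key, ← H.preimage_frontier]
    rfl

/-! ### Replacing the part of a cobordism in a box -/

section Replacement

variable {B : Finset Circle} {O O' : Smoothing B}

/-- A properly embedded surface with the same boundary as a cobordism is a cobordism. -/
def Cobordism.ofCarrier (C : Cobordism O O') (S : Set Cylinder) (hS : IsProperHypersurface 1 S)
    (h : ∀ q ∈ cylinderBoundary, q ∈ S ↔ q ∈ C.carrier) : Cobordism O O' where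
  carrier := S
  proper := hS
  top p hp := (h p (Or.inr (Or.inr hp))).trans (C.top p hp)
  bottom p hp := (h p (Or.inr (Or.inl hp))).trans (C.bottom p hp)
  side p hp := (h p (Or.inl hp)).trans (C.side p hp)

theorem Cobordism.toLinear_eq (R : Type*) [Ring R] {C C' : Cobordism O O'}
    (h : IsotopicRelBoundary C.carrier C'.carrier) : C.toLinear R = C'.toLinear R := by
  unfold Cobordism.toLinear
  congr 1
  exact Quotient.sound (s := Cobordism.isotopySetoid O O') h

variable {C C' : Cobordism O O'} {φ : (ℝ × ℝ) × ℝ → Cylinder} {n m : ℕ} {P P' : Set (ℝ × ℝ)}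

theorem Cobordism.IsReplacement.mem_iff {M : Set ((ℝ × ℝ) × ℝ)} (h : C.IsReplacement φ n M C')
    (hφ : IsInteriorChart φ) {x : (ℝ × ℝ) × ℝ} (hx : x ∈ box n) : φ x ∈ C'.carrier ↔ x ∈ M := by
  have h1 : φ x ∈ φ '' box n := ⟨x, hx, rfl⟩
  rw [h]
  simp [h1, hφ.1.injective.mem_set_image, hx]

theorem Cobordism.IsReplacement.mem_iff_of_notMem {M : Set ((ℝ × ℝ) × ℝ)}
    (h : C.IsReplacement φ n M C') {q : Cylinder} (hq : q ∉ φ '' box n) :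
    q ∈ C'.carrier ↔ q ∈ C.carrier := by
  have h1 : q ∉ φ '' (box n ∩ M) := fun h => hq (Set.image_mono Set.inter_subset_left h)
  rw [h]
  simp [h1, hq]

theorem Cobordism.isReplacement_of {M : Set ((ℝ × ℝ) × ℝ)}
    (h1 : ∀ x ∈ box n, φ x ∈ C'.carrier ↔ x ∈ M)
    (h2 : ∀ q ∉ φ '' box n, q ∈ C'.carrier ↔ q ∈ C.carrier) : C.IsReplacement φ n M C' := by
  unfold Cobordism.IsReplacement
  ext q
  by_cases hq : q ∈ φ '' box n
  · obtain ⟨x, hx, rfl⟩ := hq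
    have h3 : φ x ∈ φ '' box n := ⟨x, hx, rfl⟩
    simp only [Set.mem_union, Set.mem_sdiff, h3, not_true, and_false, false_or]
    refine ⟨fun h => ⟨x, ⟨hx, (h1 x hx).1 h⟩, rfl⟩, ?_⟩
    rintro ⟨y, ⟨hy, hyM⟩, hxy⟩
    rw [← hxy]
    exact (h1 y hy).2 hyM
  · have h3 : q ∉ φ '' (box n ∩ M) := fun h => hq (Set.image_mono Set.inter_subset_left h)
    rw [h2 q hq]
    simp [h3, hq]

theorem Cobordism.HasDisks.mem_iff (h : C.HasDisks φ n) {x : (ℝ × ℝ) × ℝ} (hx : x ∈ box n) :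
    φ x ∈ C.carrier ↔ x ∈ thickSurface (fingers n) := by
  have h1 : φ x ∈ φ '' box n := ⟨x, hx, rfl⟩
  have := Set.ext_iff.1 h.2 (φ x)
  simpa [h1, h.1.1.injective.mem_set_image, hx, diskPicture] using this

theorem Cobordism.hasDisks_of (hφ : IsInteriorChart φ)
    (h : ∀ x ∈ box n, φ x ∈ C.carrier ↔ x ∈ thickSurface (fingers n)) : C.HasDisks φ n := by
  refine ⟨hφ, ?_⟩
  ext q
  constructor
  · rintro ⟨hq, x, hx, rfl⟩
    exact ⟨x, ⟨hx, (h x hx).1 hq⟩, rfl⟩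
  · rintro ⟨x, ⟨hx, hxM⟩, rfl⟩
    exact ⟨(h x hx).2 hxM, x, hx, rfl⟩

/-- Deforming a planar picture inside the box does not change the class of the cobordism. -/
theorem Cobordism.IsReplacement.exists_of_deforms (R : Type*) [Ring R] (hφ : IsInteriorChart φ)
    (h : C.IsReplacement φ n (thickSurface P) C') (hP : Deforms n P P') :
    ∃ C'' : Cobordism O O', C.IsReplacement φ n (thickSurface P') C'' ∧
      C''.toLinear R = C'.toLinear R := by
  obtain ⟨H, hH, hHP⟩ := hP.exists_homeomorph
  obtain ⟨g, hg, hg'⟩ := hφ.1.exists_homeomorph_extend H (isCompact_box n) hH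
  have hgs : ∀ q ∉ φ '' box n, g.symm q = q := fun q hq => by
    rw [Homeomorph.symm_apply_eq, hg' q hq]
  have hgs' : ∀ x, g.symm (φ (H x)) = φ x := fun x => by
    rw [Homeomorph.symm_apply_eq, hg]
  have hbd : ∀ q ∈ cylinderBoundary, q ∉ φ '' box n := by
    rintro _ hq ⟨x, -, rfl⟩
    exact hφ.2 x hq
  -- The new surface is the image of the old one under g, so it is proper without any inspection of
  -- the picture.
  let C'' := C'.ofCarrier (g.symm ⁻¹' C'.carrier) (C'.proper.preimage_homeomorph g.symm)
    fun q hq => by rw [Set.mem_preimage, hgs q (hbd q hq)]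
  have hHbox : ∀ x, H x ∈ box n ↔ x ∈ box n := fun x => by
    constructor
    · intro hx
      by_contra hx'
      exact hx' (hH x hx' ▸ hx)
    · intro hx
      by_contra hx'
      exact hx' (by rwa [H.injective (hH _ hx')])
  refine ⟨C'', Cobordism.isReplacement_of (fun x hx => ?_) (fun q hq => ?_),
    (Cobordism.toLinear_eq R ?_).symm⟩
  · change g.symm (φ x) ∈ C'.carrier ↔ _
    obtain ⟨y, rfl⟩ := H.surjective x
    rw [hgs', h.mem_iff hφ ((hHbox y).1 hx), hHP]
  · change g.symm q ∈ C'.carrier ↔ _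
    rw [hgs q hq, h.mem_iff_of_notMem hq]
  · refine isotopicRelBoundary_of_homeomorph hφ (isCompact_box n) (starConvex_box n) H hH
      (fun p => ?_) (fun q hq => ?_)
    · change _ ↔ g.symm (φ (H p)) ∈ C'.carrier
      rw [hgs']
    · change _ ↔ g.symm q ∈ C'.carrier
      rw [hgs q hq]

/-- The chart obtained from `φ` by a change of the planar coordinates. -/
def planarReparam (φ : (ℝ × ℝ) × ℝ → Cylinder) (ψ : (ℝ × ℝ) ≃ₜ (ℝ × ℝ)) :
    (ℝ × ℝ) × ℝ → Cylinder := fun x => φ (ψ x.1, x.2)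

theorem IsInteriorChart.planarReparam (hφ : IsInteriorChart φ) (ψ : (ℝ × ℝ) ≃ₜ (ℝ × ℝ)) :
    IsInteriorChart (planarReparam φ ψ) :=
  ⟨hφ.1.comp (ψ.prodCongr (Homeomorph.refl ℝ)).isOpenEmbedding, fun _ => hφ.2 _⟩

/-- `ψ` embeds the box with `m` sites into the box with `n` sites, compatibly with the sites. -/
def IsSubbox (n m : ℕ) (U : Set (ℝ × ℝ)) (ψ : (ℝ × ℝ) ≃ₜ (ℝ × ℝ)) : Prop :=
  IsOpen U ∧ planarBox m ⊆ U ∧ (∀ u ∈ planarBox m, ψ u ∈ planarBox n) ∧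
    ∀ u ∈ U, ψ u ∈ fingers n ↔ u ∈ fingers m

/-- The planar picture `P` in the box with `n` sites is, via `ψ`, the planar picture `P'` in the
box with `m` sites. -/
def RestrictsTo (n m : ℕ) (U : Set (ℝ × ℝ)) (ψ : (ℝ × ℝ) ≃ₜ (ℝ × ℝ)) (P P' : Set (ℝ × ℝ)) : Prop :=
  (∀ u ∈ U, ψ u ∈ P ↔ u ∈ P') ∧ ∀ u ∉ planarBox m, ψ u ∈ P ↔ ψ u ∈ fingers n

/-- Here the open set U matters: frontier membership over the edge of a box depends on the region on
both sides of the edge, so agreement on the closed box alone would not suffice. -/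
theorem mem_thickSurface_reparam {U : Set (ℝ × ℝ)} (hU : IsOpen U) {ψ : (ℝ × ℝ) ≃ₜ (ℝ × ℝ)}
    (h : ∀ u ∈ U, ψ u ∈ P ↔ u ∈ P') {u : ℝ × ℝ} (hu : u ∈ U) (z : ℝ) :
    (ψ u, z) ∈ thickSurface P ↔ (u, z) ∈ thickSurface P' := by
  rw [mem_thickSurface_homeomorph]
  refine mem_thickSurface_iff_of_eventually ?_ z
  filter_upwards [hU.mem_nhds hu] with v hv
  exact h v hv

theorem Cobordism.HasDisks.reparam (h : C.HasDisks φ n) {U : Set (ℝ × ℝ)}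
    {ψ : (ℝ × ℝ) ≃ₜ (ℝ × ℝ)} (hψ : IsSubbox n m U ψ) : C.HasDisks (planarReparam φ ψ) m := by
  refine Cobordism.hasDisks_of (h.1.planarReparam ψ) fun x hx => ?_
  rw [mem_box] at hx
  rw [planarReparam, h.mem_iff (x := (ψ x.1, x.2)) (mem_box.2 ⟨hψ.2.2.1 _ hx.1, hx.2⟩)]
  exact mem_thickSurface_reparam hψ.1 hψ.2.2.2 (hψ.2.1 hx.1) _

/-- The cobordism C' is unchanged and only the ball shrinks. Inside the small ball the pictures
correspond; between the two balls P coincides with the fingers, so C' coincides with C there. -/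
theorem Cobordism.IsReplacement.reparam (h : C.IsReplacement φ n (thickSurface P) C')
    (hC : C.HasDisks φ n) {U : Set (ℝ × ℝ)} {ψ : (ℝ × ℝ) ≃ₜ (ℝ × ℝ)} (hψ : IsSubbox n m U ψ)
    (hP : RestrictsTo n m U ψ P P') :
    C.IsReplacement (planarReparam φ ψ) m (thickSurface P') C' := by
  refine Cobordism.isReplacement_of (fun x hx => ?_) (fun q hq => ?_)
  · rw [mem_box] at hx
    rw [planarReparam, h.mem_iff hC.1 (x := (ψ x.1, x.2)) (mem_box.2 ⟨hψ.2.2.1 _ hx.1, hx.2⟩)]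
    exact mem_thickSurface_reparam hψ.1 hP.1 (hψ.2.1 hx.1) _
  · by_cases hq' : q ∈ φ '' box n
    · obtain ⟨⟨p, z⟩, hy, rfl⟩ := hq'
      rw [h.mem_iff hC.1 hy, hC.mem_iff hy]
      obtain ⟨u, rfl⟩ := ψ.surjective p
      have hu : u ∉ planarBox m := fun hu =>
        hq ⟨(u, z), mem_box.2 ⟨hu, (mem_box.1 hy).2⟩, rfl⟩
      rw [mem_thickSurface_homeomorph, mem_thickSurface_homeomorph]
      refine mem_thickSurface_iff_of_eventually ?_ z
      filter_upwards [(isCompact_planarBox m).isClosed.isOpen_compl.mem_nhds hu] with v hv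
      exact hP.2 v hv
    · exact h.mem_iff_of_notMem hq'

/-! ### Existence of replacements -/

/-- The surface of the thickening of `P` is locally flat above the planar point `p`. -/
def PlanarFlat (P : Set (ℝ × ℝ)) (p : ℝ × ℝ) : Prop := ∀ z, FlatAt 1 (thickSurface P) (p, z)

theorem PlanarFlat.congr {p : ℝ × ℝ} (h : PlanarFlat P p) (hP : ∀ᶠ q in 𝓝 p, q ∈ P ↔ q ∈ P') :
    PlanarFlat P' p := fun z => (h z).congr (eventually_mem_thickSurface_iff hP z)

theorem PlanarFlat.preimage {p : ℝ × ℝ} {ψ : (ℝ × ℝ) ≃ₜ (ℝ × ℝ)} (h : PlanarFlat P (ψ p)) :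
    PlanarFlat (ψ ⁻¹' P) p := fun z => by
  have h1 := (flatAt_preimage_iff (ψ.prodCongr (Homeomorph.refl ℝ)).isOpenEmbedding
    (a := (p, z))).2 (h z)
  refine h1.congr (Filter.Eventually.of_forall fun x => ?_)
  exact mem_thickSurface_homeomorph ψ P x.1 x.2

theorem eventually_mem_box {p : ℝ × ℝ} (hp : p ∈ openPlanarBox n) {z : ℝ} (hz : |z| < 2) :
    ∀ᶠ x in 𝓝 (p, z), x ∈ box n := by
  have h1 : ∀ᶠ x : (ℝ × ℝ) × ℝ in 𝓝 (p, z), x.1 ∈ openPlanarBox n :=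
    continuousAt_fst.eventually ((isOpen_openPlanarBox n).mem_nhds hp)
  have h2 : ∀ᶠ x : (ℝ × ℝ) × ℝ in 𝓝 (p, z), |x.2| < 2 :=
    (continuous_abs.comp continuous_snd).continuousAt.eventually_lt continuousAt_const hz
  filter_upwards [h1, h2] with x hx hx'
  exact mem_box.2 ⟨openPlanarBox_subset n hx, abs_le.1 hx'.le⟩

/-- Flatness of a model picture, edges included, is read off from a cobordism that contains it; no
flat chart around an edge is ever written down. -/
theorem Cobordism.IsReplacement.planarFlat (h : C.IsReplacement φ n (thickSurface P) C')
    (hφ : IsInteriorChart φ) {p : ℝ × ℝ} (hp : p ∈ openPlanarBox n) : PlanarFlat P p := by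
  intro z
  by_cases hz : |z| < 2
  · have h1 := (flatAt_preimage_iff hφ.1 (a := (p, z))).2
      (isProperHypersurface_iff_flatAt.1 C'.proper (φ (p, z)))
    refine h1.congr ?_
    filter_upwards [eventually_mem_box hp hz] with x hx
    exact h.mem_iff hφ hx
  · left
    refine eventually_notMem_thickSurface P fun h => hz ?_
    exact (abs_le.2 h).trans_lt (by norm_num)

/-- A planar picture that is locally flat and standard near the boundary of the box can be
inserted into a cobordism with disks. -/
theorem Cobordism.HasDisks.exists_isReplacement (hC : C.HasDisks φ n)
    (h1 : ∀ p ∉ openPlanarBox n, ∀ᶠ q in 𝓝 p, q ∈ P ↔ q ∈ fingers n)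
    (h2 : ∀ p ∈ openPlanarBox n, PlanarFlat P p) :
    ∃ C' : Cobordism O O', C.IsReplacement φ n (thickSurface P) C' := by
  have hφ := hC.1
  set S : Set Cylinder := (C.carrier \ φ '' box n) ∪ φ '' (box n ∩ thickSurface P) with hS
  have hSin : ∀ x ∈ box n, φ x ∈ S ↔ x ∈ thickSurface P := fun x hx => by
    have h1 : φ x ∈ φ '' box n := ⟨x, hx, rfl⟩
    simp [hS, h1, hφ.1.injective.mem_set_image, hx]
  have hSout : ∀ q ∉ φ '' box n, q ∈ S ↔ q ∈ C.carrier := fun q hq => by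
    have h3 : q ∉ φ '' (box n ∩ thickSurface P) :=
      fun h => hq (Set.image_mono Set.inter_subset_left h)
    simp [hS, h3, hq]
  have hCflat := isProperHypersurface_iff_flatAt.1 C.proper
  have hproper : IsProperHypersurface 1 S := by
    rw [isProperHypersurface_iff_flatAt]
    intro q
    by_cases hq : q ∈ φ '' box n
    · obtain ⟨⟨p, z⟩, hx, rfl⟩ := hq
      rw [← flatAt_preimage_iff hφ.1]
      -- Wherever the picture is locally standard, the new surface agrees with C nearby, both inside
      -- and outside the ball, and inherits its flatness. This covers all the faces of the box.
      have hstd : (∀ᶠ x in 𝓝 (p, z), x ∈ thickSurface P ↔ x ∈ thickSurface (fingers n)) →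
          FlatAt 1 (φ ⁻¹' S) (p, z) := fun hev => by
        refine ((flatAt_preimage_iff hφ.1).2 (hCflat (φ (p, z)))).congr ?_
        filter_upwards [hev] with x hx
        by_cases hxb : x ∈ box n
        · simp only [Set.mem_preimage]
          rw [hC.mem_iff hxb, hSin x hxb, hx]
        · have : φ x ∉ φ '' box n := by rwa [hφ.1.injective.mem_set_image]
          exact (hSout _ this).symm
      by_cases hp : p ∈ openPlanarBox n
      · by_cases hz : |z| < 2
        · refine (h2 p hp z).congr ?_
          filter_upwards [eventually_mem_box hp hz] with x hx
          exact (hSin x hx).symm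
        · have hz' : z ∉ Set.Icc (-1 : ℝ) 1 :=
            fun h => hz ((abs_le.2 h).trans_lt (by norm_num))
          refine hstd ?_
          filter_upwards [eventually_notMem_thickSurface P hz',
            eventually_notMem_thickSurface (fingers n) hz'] with x h3 h4
          simp [h3, h4]
      · exact hstd (eventually_mem_thickSurface_iff (h1 p hp) z)
    · refine (hCflat q).congr ?_
      have : (φ '' box n)ᶜ ∈ 𝓝 q :=
        ((isCompact_box n).image hφ.1.continuous).isClosed.isOpen_compl.mem_nhds hq
      filter_upwards [this] with q' hq'
      exact (hSout q' hq').symm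
  refine ⟨C.ofCarrier S hproper fun q hq => hSout q ?_, rfl⟩
  rintro ⟨x, -, rfl⟩
  exact hφ.2 x hq

end Replacement

/-! ### Piecewise linear slides -/

/-- The piecewise linear map of the line that fixes everything outside `[lo, hi]`, maps `a` to `a'`
and is affine on `[lo, a]` and on `[a, hi]`. -/
noncomputable def slide (lo hi a a' t : ℝ) : ℝ :=
  t + (a' - a) * max 0 (min ((t - lo) / (a - lo)) ((hi - t) / (hi - a)))

section Slide

variable {lo hi a a' t : ℝ}

theorem slide_of_le (h1 : lo < a) (h : t ≤ lo) : slide lo hi a a' t = t := by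
  have : (t - lo) / (a - lo) ≤ 0 := div_nonpos_of_nonpos_of_nonneg (by linarith) (by linarith)
  rw [slide, max_eq_left ((min_le_left _ _).trans this)]; ring

theorem slide_of_ge (h2 : a < hi) (h : hi ≤ t) : slide lo hi a a' t = t := by
  have : (hi - t) / (hi - a) ≤ 0 := div_nonpos_of_nonpos_of_nonneg (by linarith) (by linarith)
  rw [slide, max_eq_left ((min_le_right _ _).trans this)]; ring

theorem slide_of_mem_left (h1 : lo < a) (h2 : a < hi) (h : lo ≤ t) (h' : t ≤ a) :
    slide lo hi a a' t = lo + (t - lo) * (a' - lo) / (a - lo) := by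
  have e1 : (t - lo) / (a - lo) ≤ 1 := (div_le_one (by linarith)).2 (by linarith)
  have e2 : 1 ≤ (hi - t) / (hi - a) := (one_le_div (by linarith)).2 (by linarith)
  have e3 : 0 ≤ (t - lo) / (a - lo) := div_nonneg (by linarith) (by linarith)
  have : a - lo ≠ 0 := by linarith
  rw [slide, min_eq_left (e1.trans e2), max_eq_right e3]
  field_simp
  ring

theorem slide_of_mem_right (h1 : lo < a) (h2 : a < hi) (h : a ≤ t) (h' : t ≤ hi) :
    slide lo hi a a' t = hi - (hi - t) * (hi - a') / (hi - a) := by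
  have e1 : (hi - t) / (hi - a) ≤ 1 := (div_le_one (by linarith)).2 (by linarith)
  have e2 : 1 ≤ (t - lo) / (a - lo) := (one_le_div (by linarith)).2 (by linarith)
  have e3 : 0 ≤ (hi - t) / (hi - a) := div_nonneg (by linarith) (by linarith)
  have : hi - a ≠ 0 := by linarith
  rw [slide, min_eq_right (e1.trans e2), max_eq_right e3]
  field_simp
  ring

theorem slide_self (lo hi a t : ℝ) : slide lo hi a a t = t := by simp [slide]

/-- The order relations between a point `t` and its image `t'` under a slide. -/
structure SlideRel (lo hi a a' t t' : ℝ) : Prop where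
  of_le : t ≤ lo → t' = t
  of_ge : hi ≤ t → t' = t
  lo_lt : lo < t → lo < t'
  lt_hi : t < hi → t' < hi
  le_iff : t ≤ a ↔ t' ≤ a'
  lt_iff : t < a ↔ t' < a'
  of_eq : a = a' → t' = t
  le_of_le : a ≤ a' → t ≤ t'

/-- These order facts replace the explicit formula: the comparisons of pictures below use nothing
else about a slide. -/
theorem slideRel (h1 : lo < a) (h2 : a < hi) (h1' : lo < a') (h2' : a' < hi) :
    SlideRel lo hi a a' t (slide lo hi a a' t) := by
  have le_of_le : a ≤ a' → t ≤ slide lo hi a a' t := fun h =>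
    le_add_of_nonneg_right (mul_nonneg (by linarith) (le_max_left _ _))
  rcases le_or_gt t lo with h | h
  · rw [slide_of_le h1 h]
    constructor <;> intros <;> first
      | rfl | linarith | (constructor <;> intro <;> linarith)
  rcases le_or_gt hi t with h' | h'
  · rw [slide_of_ge h2 h']
    constructor <;> intros <;> first
      | rfl | linarith | (constructor <;> intro <;> linarith)
  have of_eq : a = a' → slide lo hi a a' t = t := by rintro rfl; exact slide_self _ _ _ _
  rcases lt_trichotomy t a with h3 | h3 | h3
  · have e1 : 0 < (t - lo) * (a' - lo) / (a - lo) :=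
      div_pos (mul_pos (by linarith) (by linarith)) (by linarith)
    have e2 : (t - lo) * (a' - lo) / (a - lo) < a' - lo := by
      rw [div_lt_iff₀ (by linarith), mul_comm]
      exact mul_lt_mul_of_pos_left (by linarith) (by linarith)
    rw [slide_of_mem_left h1 h2 h.le h3.le] at of_eq le_of_le ⊢
    constructor <;> intros <;> first
      | exact of_eq ‹_› | exact le_of_le ‹_› | linarith | (constructor <;> intro <;> linarith)
  · subst h3
    have : slide lo hi t a' t = a' := by
      have : t - lo ≠ 0 := by linarith
      rw [slide_of_mem_left h1 h2 h.le le_rfl]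
      field_simp
      ring
    rw [this] at of_eq le_of_le ⊢
    constructor <;> intros <;> first
      | exact of_eq ‹_› | exact le_of_le ‹_› | linarith | (constructor <;> intro <;> linarith)
  · have e1 : 0 < (hi - t) * (hi - a') / (hi - a) :=
      div_pos (mul_pos (by linarith) (by linarith)) (by linarith)
    have e2 : (hi - t) * (hi - a') / (hi - a) < hi - a' := by
      rw [div_lt_iff₀ (by linarith), mul_comm]
      exact mul_lt_mul_of_pos_left (by linarith) (by linarith)
    rw [slide_of_mem_right h1 h2 h3.le h'.le] at of_eq le_of_le ⊢
    constructor <;> intros <;> first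
      | exact of_eq ‹_› | exact le_of_le ‹_› | linarith | (constructor <;> intro <;> linarith)

theorem slide_slide (h1 : lo < a) (h2 : a < hi) (h1' : lo < a') (h2' : a' < hi) :
    slide lo hi a' a (slide lo hi a a' t) = t := by
  have hr := slideRel (t := t) h1 h2 h1' h2'
  rcases le_or_gt t lo with h | h
  · rw [slide_of_le h1 h, slide_of_le h1' h]
  rcases le_or_gt hi t with h' | h'
  · rw [slide_of_ge h2 h', slide_of_ge h2' h']
  have n1 : a - lo ≠ 0 := by linarith
  have n2 : hi - a ≠ 0 := by linarith
  have n3 : a' - lo ≠ 0 := by linarith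
  have n4 : hi - a' ≠ 0 := by linarith
  rcases le_or_gt t a with h3 | h3
  · rw [slide_of_mem_left h1' h2' (hr.lo_lt h).le (hr.le_iff.1 h3),
      slide_of_mem_left h1 h2 h.le h3]
    field_simp
    ring
  · rw [slide_of_mem_right h1' h2' (not_lt.1 fun h4 => h3.not_gt (hr.lt_iff.2 h4))
      (hr.lt_hi h').le, slide_of_mem_right h1 h2 h3.le h'.le]
    field_simp
    ring

end Slide

theorem continuous_slide {X : Type*} [TopologicalSpace X] {lo hi : ℝ} {a a' t : X → ℝ}
    (ha : Continuous a) (ha' : Continuous a') (ht : Continuous t) (h : ∀ x, lo < a x ∧ a x < hi) :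
    Continuous fun x => slide lo hi (a x) (a' x) (t x) := by
  have h1 : ∀ x, a x - lo ≠ 0 := fun x => by linarith [h x]
  have h2 : ∀ x, hi - a x ≠ 0 := fun x => by linarith [h x]
  unfold slide
  fun_prop (disch := assumption)

/-- Slide the vertical lines; the line through `x` is moved from `a x` to `a' x`. -/
noncomputable def verticalSlide (lo hi : ℝ) (a a' : ℝ → ℝ) (ha : Continuous a)
    (ha' : Continuous a') (h : ∀ x, lo < a x ∧ a x < hi) (h' : ∀ x, lo < a' x ∧ a' x < hi) :
    (ℝ × ℝ) ≃ₜ (ℝ × ℝ) where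
  toFun p := (p.1, slide lo hi (a p.1) (a' p.1) p.2)
  invFun p := (p.1, slide lo hi (a' p.1) (a p.1) p.2)
  left_inv p := by simp [slide_slide (h p.1).1 (h p.1).2 (h' p.1).1 (h' p.1).2]
  right_inv p := by simp [slide_slide (h' p.1).1 (h' p.1).2 (h p.1).1 (h p.1).2]
  continuous_toFun := continuous_fst.prodMk
    (continuous_slide (ha.comp continuous_fst) (ha'.comp continuous_fst) continuous_snd
      fun p => h p.1)
  continuous_invFun := continuous_fst.prodMk
    (continuous_slide (ha'.comp continuous_fst) (ha.comp continuous_fst) continuous_snd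
      fun p => h' p.1)

theorem exists_verticalSlide {lo hi : ℝ} {a a' : ℝ → ℝ} (ha : Continuous a) (ha' : Continuous a')
    (h : ∀ x, lo < a x ∧ a x < hi) (h' : ∀ x, lo < a' x ∧ a' x < hi) :
    ∃ ψ : (ℝ × ℝ) ≃ₜ (ℝ × ℝ), ∀ p, (ψ p).1 = p.1 ∧
      SlideRel lo hi (a p.1) (a' p.1) p.2 (ψ p).2 :=
  ⟨verticalSlide lo hi a a' ha ha' h h', fun p =>
    ⟨rfl, slideRel (h p.1).1 (h p.1).2 (h' p.1).1 (h' p.1).2⟩⟩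

theorem exists_horizontalSlide {lo hi : ℝ} {a a' : ℝ → ℝ} (ha : Continuous a)
    (ha' : Continuous a') (h : ∀ y, lo < a y ∧ a y < hi) (h' : ∀ y, lo < a' y ∧ a' y < hi) :
    ∃ ψ : (ℝ × ℝ) ≃ₜ (ℝ × ℝ), ∀ p, (ψ p).2 = p.2 ∧
      SlideRel lo hi (a p.2) (a' p.2) p.1 (ψ p).1 := by
  obtain ⟨ψ, hψ⟩ := exists_verticalSlide ha ha' h h'
  refine ⟨((Homeomorph.prodComm ℝ ℝ).trans ψ).trans (Homeomorph.prodComm ℝ ℝ), fun p => ?_⟩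
  exact hψ (p.2, p.1)

/-- The support is confined vertically by `lo` and `hi`, and horizontally because a slide with a x =
a' x is trivial. What remains is a pointwise check in terms of `SlideRel`. -/
theorem Deforms.of_verticalSlide {n : ℕ} {P P' : Set (ℝ × ℝ)} {lo hi : ℝ} {a a' : ℝ → ℝ}
    (ha : Continuous a) (ha' : Continuous a') (h : ∀ x, lo < a x ∧ a x < hi)
    (h' : ∀ x, lo < a' x ∧ a' x < hi) (hlo : 0 ≤ lo) (hhi : hi ≤ 4)
    (hid : ∀ x : ℝ, x < -1 ∨ 2 * n < x → a x = a' x)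
    (hP : ∀ x y y', SlideRel lo hi (a x) (a' x) y y' → ((x, y') ∈ P' ↔ (x, y) ∈ P)) :
    Deforms n P P' := by
  obtain ⟨ψ, hψ⟩ := exists_verticalSlide ha ha' h h'
  refine ⟨ψ, fun p hp => Prod.ext (hψ p).1 ?_, fun p => ?_⟩
  · have hr := (hψ p).2
    by_cases h1 : p.1 < -1 ∨ 2 * (n : ℝ) < p.1
    · exact hr.of_eq (hid _ h1)
    by_cases h2 : p.2 ≤ lo
    · exact hr.of_le h2
    by_cases h3 : hi ≤ p.2
    · exact hr.of_ge h3
    push Not at h1 h2 h3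
    exact absurd ⟨h1, by linarith, by linarith⟩ hp
  · have e : ψ p = (p.1, (ψ p).2) := Prod.ext (hψ p).1 rfl
    rw [e, hP _ _ _ (hψ p).2]

theorem Deforms.of_horizontalSlide {n : ℕ} {P P' : Set (ℝ × ℝ)} {lo hi : ℝ} {a a' : ℝ → ℝ}
    (ha : Continuous a) (ha' : Continuous a') (h : ∀ y, lo < a y ∧ a y < hi)
    (h' : ∀ y, lo < a' y ∧ a' y < hi) (hlo : -1 ≤ lo) (hhi : hi ≤ 2 * n)
    (hid : ∀ y : ℝ, y < 0 ∨ 4 < y → a y = a' y)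
    (hP : ∀ x x' y, SlideRel lo hi (a y) (a' y) x x' → ((x', y) ∈ P' ↔ (x, y) ∈ P)) :
    Deforms n P P' := by
  obtain ⟨ψ, hψ⟩ := exists_horizontalSlide ha ha' h h'
  refine ⟨ψ, fun p hp => Prod.ext ?_ (hψ p).1, fun p => ?_⟩
  · have hr := (hψ p).2
    by_cases h1 : p.2 < 0 ∨ 4 < p.2
    · exact hr.of_eq (hid _ h1)
    by_cases h2 : p.1 ≤ lo
    · exact hr.of_le h2
    by_cases h3 : hi ≤ p.1
    · exact hr.of_ge h3
    push Not at h1 h2 h3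
    exact absurd ⟨by constructor <;> linarith, h1⟩ hp
  · have e : ψ p = ((ψ p).1, p.2) := Prod.ext rfl (hψ p).1
    rw [e, hP _ _ _ (hψ p).2]

/-! ### Planar pictures -/

/-- An arch that rests on site `i`, with right leg between `x = l` and `x = r`. -/
def bridge (i : ℕ) (l r : ℝ) : Set (ℝ × ℝ) :=
  {p | 2 * i ≤ p.1 ∧ p.1 ≤ r ∧ p.2 ≤ 3 ∧ ¬ (2 * i + 1 < p.1 ∧ p.1 < l ∧ p.2 < 2)}

/-- A finger of height `3` at site `k`, with a hole between `x = l` and `x = r`. -/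
def tallLoop (k : ℕ) (l r : ℝ) : Set (ℝ × ℝ) :=
  {p | 2 * k ≤ p.1 ∧ p.1 ≤ 2 * k + 1 ∧ p.2 ≤ 3 ∧ ¬ (l < p.1 ∧ p.1 < r ∧ p.2 < 2)}

/-- A rectangular hole inside a finger. -/
def hole (l r : ℝ) : Set (ℝ × ℝ) :=
  {p | l < p.1 ∧ p.1 < r ∧ 1 / 4 < p.2 ∧ p.2 < 3 / 4}

theorem arch_eq_bridge (i j : ℕ) : arch i j = bridge i (2 * j) (2 * j + 1) := rfl

theorem window_eq_hole (i : ℕ) : window i = hole (2 * i + 1 / 4) (2 * i + 3 / 4) := rfl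

theorem mem_fingers_succ {n : ℕ} {p : ℝ × ℝ} :
    p ∈ fingers (n + 1) ↔ p ∈ fingers n ∨ p ∈ finger n := by
  constructor
  · rintro ⟨k, hk, hp⟩
    rcases Nat.lt_succ_iff_lt_or_eq.1 hk with h | rfl
    · exact Or.inl ⟨k, h, hp⟩
    · exact Or.inr hp
  · rintro (⟨k, hk, hp⟩ | hp)
    · exact ⟨k, hk.trans n.lt_succ_self, hp⟩
    · exact ⟨n, n.lt_succ_self, hp⟩

theorem fst_le_of_mem_fingers {n : ℕ} {p : ℝ × ℝ} (h : p ∈ fingers n) : p.1 ≤ 2 * n - 1 := by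
  obtain ⟨k, hk, hp⟩ := h
  have : (k : ℝ) + 1 ≤ n := by exact_mod_cast hk
  linarith [hp.2.1]

theorem mem_fingers_succ_of_lt {n : ℕ} {x y : ℝ} (h : 2 * n - 1 < x) :
    (x, y) ∈ fingers (n + 1) ↔ 2 * n ≤ x ∧ x ≤ 2 * n + 1 ∧ y ≤ 1 := by
  rw [mem_fingers_succ, or_iff_right fun h' => absurd (fst_le_of_mem_fingers h') (not_le.2 h)]
  rfl

theorem lerp_mem {lo hi a a' c : ℝ} (h : lo < a ∧ a < hi) (h' : lo < a' ∧ a' < hi) (hc : 0 ≤ c)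
    (hc' : c ≤ 1) : lo < a + c * (a' - a) ∧ a + c * (a' - a) < hi := by
  rcases le_total a a' with ha | ha
  · have h1 : 0 ≤ c * (a' - a) := mul_nonneg hc (by linarith)
    have h2 : c * (a' - a) ≤ a' - a := mul_le_of_le_one_left (by linarith) hc'
    constructor <;> linarith
  · have h1 : 0 ≤ c * (a - a') := mul_nonneg hc (by linarith)
    have h2 : c * (a - a') ≤ a - a' := mul_le_of_le_one_left (by linarith) hc'
    constructor <;> linarith

theorem deforms_hole {k : ℕ} {p q p' q' : ℝ} (hp : 2 * k < p) (hpq : p < q) (hq : q < 2 * k + 1)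
    (hp' : 2 * k < p') (hpq' : p' < q') (hq' : q' < 2 * k + 1) :
    Deforms (k + 1) (fingers (k + 1) \ hole p q) (fingers (k + 1) \ hole p' q') := by
  have hk : (0 : ℝ) ≤ k := k.cast_nonneg
  set χ : ℝ → ℝ := fun y => max 0 (min 1 (min (4 * y) (4 - 4 * y))) with hχ
  have hχc : Continuous χ := by fun_prop
  have hχ0 : ∀ y, 0 ≤ χ y := fun y => le_max_left _ _
  have hχ1 : ∀ y, χ y ≤ 1 := fun y => max_le zero_le_one (min_le_left _ _)
  have hχ2 : ∀ y, y ≤ 0 ∨ 1 ≤ y → χ y = 0 := fun y hy => by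
    refine max_eq_left ((min_le_right _ _).trans ?_)
    rcases hy with hy | hy
    · exact (min_le_left _ _).trans (by linarith)
    · exact (min_le_right _ _).trans (by linarith)
  have hχ3 : ∀ y, 1 / 4 < y → y < 3 / 4 → χ y = 1 := fun y hy hy' => by
    simp only [hχ]
    rw [min_eq_left (le_min (by linarith) (by linarith)), max_eq_right zero_le_one]
  -- moving one side of the hole
  have key : ∀ p q p' q' lo hi a a' : ℝ, 2 * k ≤ lo → hi ≤ 2 * k + 1 → lo < a → a < hi → lo < a' →
      a' < hi → (p = a ∧ p' = a' ∧ q = hi ∧ q' = hi ∨ q = a ∧ q' = a' ∧ p = lo ∧ p' = lo) →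
      Deforms (k + 1) (fingers (k + 1) \ hole p q) (fingers (k + 1) \ hole p' q') := by
    intro p q p' q' lo hi a a' hlo hhi h1 h2 h1' h2' hpq
    have hco : ∀ y, lo < a + χ y * (a' - a) ∧ a + χ y * (a' - a) < hi :=
      fun y => lerp_mem ⟨h1, h2⟩ ⟨h1', h2'⟩ (hχ0 y) (hχ1 y)
    refine Deforms.of_horizontalSlide (lo := lo) (hi := hi) (a := fun _ => a)
      (a' := fun y => a + χ y * (a' - a)) continuous_const (by fun_prop) (fun _ => ⟨h1, h2⟩) hco
      (by linarith) (by push_cast; linarith) (fun y hy => ?_) fun x x' y hr => ?_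
    · rw [hχ2 y (by rcases hy with hy | hy <;> [left; right] <;> linarith)]; ring
    · have hf : (x', y) ∈ fingers (k + 1) ↔ (x, y) ∈ fingers (k + 1) := by
        by_cases hx : x ≤ lo
        · rw [hr.of_le hx]
        by_cases hx' : hi ≤ x
        · rw [hr.of_ge hx']
        have e1 := hr.lo_lt (not_le.1 hx)
        have e2 := hr.lt_hi (not_le.1 hx')
        rw [mem_fingers_succ_of_lt (by linarith), mem_fingers_succ_of_lt (by linarith)]
        grind
      have hh : (x', y) ∈ hole p' q' ↔ (x, y) ∈ hole p q := by
        by_cases hy : 1 / 4 < y ∧ y < 3 / 4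
        · obtain ⟨e1, e2, e3, e4, e5, e6, e7, -⟩ := hr
          rw [hχ3 y hy.1 hy.2] at e5 e6
          simp only [hole, Set.mem_ofPred_eq]
          grind
        · simp only [hole, Set.mem_ofPred_eq]
          grind
      simp only [Set.mem_sdiff, hf, hh]
  -- The sides move one at a time. Moving the left side first to min p p' keeps it to the left of
  -- both q and q', so the hole never closes up.
  have hm := min_le_left p p'
  have hm' := min_le_right p p'
  have hm0 : 2 * (k : ℝ) < min p p' := lt_min hp hp'
  refine (key p q (min p p') q (2 * k) q p (min p p') le_rfl hq.le hp hpq hm0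
    (hm.trans_lt hpq) (Or.inl ⟨rfl, rfl, rfl, rfl⟩)).trans ?_
  refine (key (min p p') q (min p p') q' (min p p') (2 * k + 1) q q' hm0.le le_rfl
    (hm.trans_lt hpq) hq (hm'.trans_lt hpq') hq' (Or.inr ⟨rfl, rfl, rfl, rfl⟩)).trans ?_
  exact key (min p p') q' p' q' (2 * k) q' (min p p') p' le_rfl hq'.le hm0 (hm'.trans_lt hpq')
    hp' hpq' (Or.inl ⟨rfl, rfl, rfl, rfl⟩)
theorem mem_bridge {i : ℕ} {l r x y : ℝ} : (x, y) ∈ bridge i l r ↔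
    2 * i ≤ x ∧ x ≤ r ∧ y ≤ 3 ∧ ¬ (2 * i + 1 < x ∧ x < l ∧ y < 2) := Iff.rfl

/-- The leg is widened by filling the step between its right wall and the finger top, in two slides.
The intermediate picture has a slanted edge from (2k + 1/3, 5/2) to (2k + 1, 3/2), which is a graph
over both axes: a vertical slide raises the finger top to it, and a horizontal slide pushes it out
to the right side of the finger. -/
theorem deforms_widen_right {i k : ℕ} (hik : i < k) :
    Deforms (k + 1) (fingers (k + 1) ∪ bridge i (2 * k) (2 * k + 1 / 3))
      (fingers (k + 1) ∪ bridge i (2 * k) (2 * k + 1)) := by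
  have hk : (i : ℝ) + 1 ≤ k := by exact_mod_cast hik
  have hi0 : (0 : ℝ) ≤ i := i.cast_nonneg
  set f : ℝ → ℝ := fun x => max 1 (min (1 + 9 / 2 * (x - 2 * k)) (3 - 3 / 2 * (x - 2 * k))) with hf
  have hf1 : ∀ x : ℝ, x ≤ 2 * k ∨ 2 * k + 4 / 3 ≤ x → f x = 1 := fun x hx => by
    refine max_eq_left ?_
    rcases hx with hx | hx
    · exact (min_le_left _ _).trans (by linarith)
    · exact (min_le_right _ _).trans (by linarith)
  have hf2 : ∀ x : ℝ, 2 * k + 1 / 3 ≤ x → x ≤ 2 * k + 1 → f x = 3 - 3 / 2 * (x - 2 * k) :=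
    fun x hx hx' => by
      simp only [hf]
      rw [min_eq_right (by linarith), max_eq_right (by linarith)]
  have hf3 : ∀ x, 1 / 2 < f x ∧ f x < 3 := fun x => by
    refine ⟨lt_max_of_lt_left (by norm_num), max_lt (by norm_num) ?_⟩
    rcases le_total (x - 2 * k) (1 / 3) with hx | hx
    · exact min_lt_of_left_lt (by linarith)
    · exact min_lt_of_right_lt (by linarith)
  -- Up to height 3 this is the right edge of the intermediate picture. Above it, g returns to 2k +
  -- 1, reached at height 11/3, so that the slide is trivial outside the box.
  set g : ℝ → ℝ := fun y => 2 * k + min 1 (max (max (1 / 3) (2 - 2 / 3 * y)) (y - 8 / 3)) with hg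
  have hg1 : ∀ y, y ≤ 3 / 2 ∨ 11 / 3 ≤ y → g y = 2 * k + 1 := fun y hy => by
    simp only [hg]
    rw [min_eq_left]
    rcases hy with hy | hy
    · exact le_max_of_le_left (le_max_of_le_right (by linarith))
    · exact le_max_of_le_right (by linarith)
  have hg2 : ∀ y, 3 / 2 ≤ y → y ≤ 5 / 2 → g y = 2 * k + (2 - 2 / 3 * y) := fun y hy hy' => by
    simp only [hg]
    rw [max_eq_right (a := 1 / 3) (by linarith), max_eq_left (by linarith),
      min_eq_right (by linarith)]
  have hg3 : ∀ y, 5 / 2 ≤ y → y ≤ 3 → g y = 2 * k + 1 / 3 := fun y hy hy' => by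
    simp only [hg]
    rw [max_eq_left (a := 1 / 3) (by linarith), max_eq_left (by linarith),
      min_eq_right (by linarith)]
  have hg4 : ∀ y, 2 * k < g y ∧ g y < 2 * k + 3 / 2 := fun y => by
    have h1 : 0 < min (1 : ℝ) (max (max (1 / 3) (2 - 2 / 3 * y)) (y - 8 / 3)) :=
      lt_min (by norm_num) (lt_max_of_lt_left (lt_max_of_lt_left (by norm_num)))
    have h2 : min (1 : ℝ) (max (max (1 / 3) (2 - 2 / 3 * y)) (y - 8 / 3)) ≤ 1 := min_le_left _ _
    constructor <;> linarith
  have hfc : Continuous f := by fun_prop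
  have hgc : Continuous g := by fun_prop
  clear_value f g
  refine Deforms.trans (P' := fingers (k + 1) ∪ bridge i (2 * k) (2 * k + 1 / 3) ∪
    {p | 2 * k + 1 / 3 ≤ p.1 ∧ p.1 ≤ 2 * k + 1 ∧ p.2 ≤ 3 - 3 / 2 * (p.1 - 2 * k)}) ?_ ?_
  · refine Deforms.of_verticalSlide (lo := 1 / 2) (hi := 3) (a := fun _ => 1) (a' := f)
      continuous_const hfc (fun _ => by norm_num) hf3 (by norm_num) (by norm_num)
      (fun x hx => ?_) fun x y y' hr => ?_
    · rw [hf1]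
      push_cast at hx
      rcases hx with hx | hx
      · left; linarith
      · right; linarith
    · obtain ⟨e1, e2, e3, e4, e5, e6, e7, -⟩ := hr
      by_cases hx : x ≤ 2 * k
      · rw [e7 (hf1 x (Or.inl hx)).symm]
        simp only [Set.mem_union, mem_bridge, Set.mem_ofPred_eq]
        grind
      · have hx' : 2 * k - 1 < x := by linarith
        simp only [Set.mem_union, mem_bridge, Set.mem_ofPred_eq, mem_fingers_succ_of_lt hx']
        have := hf2 x
        grind
  · refine Deforms.of_horizontalSlide (lo := 2 * k) (hi := 2 * k + 3 / 2) (a := g)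
      (a' := fun _ => 2 * k + 1) hgc continuous_const hg4
      (fun _ => by constructor <;> linarith) (by linarith) (by push_cast; linarith)
      (fun y hy => ?_) fun x x' y hr => ?_
    · rw [hg1]
      rcases hy with hy | hy
      · left; linarith
      · right; linarith
    · obtain ⟨e1, e2, e3, e4, e5, e6, e7, -⟩ := hr
      by_cases hx : x ≤ 2 * k
      · rw [e1 hx]
        simp only [Set.mem_union, mem_bridge, Set.mem_ofPred_eq]
        grind
      · have hx' : 2 * k - 1 < x := by linarith
        have hx'' : 2 * k - 1 < x' := by linarith [e3 (not_le.1 hx)]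
        simp only [Set.mem_union, mem_bridge, Set.mem_ofPred_eq, mem_fingers_succ_of_lt hx',
          mem_fingers_succ_of_lt hx'']
        have h1 := hg1 y
        have h2 := hg2 y
        have h3 := hg3 y
        grind
-- The same device on the other side of the leg, under the arch: the slanted edge runs from (2k,
-- 5/4) to (2k + 2/3, 7/4), below the ceiling at height 2.
theorem deforms_widen_left {i k : ℕ} (hik : i < k) :
    Deforms (k + 1) (fingers (k + 1) ∪ bridge i (2 * k + 2 / 3) (2 * k + 1))
      (fingers (k + 1) ∪ bridge i (2 * k) (2 * k + 1)) := by
  have hk : (i : ℝ) + 1 ≤ k := by exact_mod_cast hik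
  have hi0 : (0 : ℝ) ≤ i := i.cast_nonneg
  set f : ℝ → ℝ := fun x =>
    max 1 (min (5 / 4 + 3 / 4 * (x - 2 * k)) (13 / 4 - 9 / 4 * (x - 2 * k))) with hf
  have hf1 : ∀ x : ℝ, x ≤ 2 * k - 1 / 3 ∨ 2 * k + 1 ≤ x → f x = 1 := fun x hx => by
    refine max_eq_left ?_
    rcases hx with hx | hx
    · exact (min_le_left _ _).trans (by linarith)
    · exact (min_le_right _ _).trans (by linarith)
  have hf2 : ∀ x : ℝ, 2 * k ≤ x → x ≤ 2 * k + 2 / 3 → f x = 5 / 4 + 3 / 4 * (x - 2 * k) :=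
    fun x hx hx' => by
      simp only [hf]
      rw [min_eq_left (by linarith), max_eq_right (by linarith)]
  have hf3 : ∀ x, 1 / 2 < f x ∧ f x < 2 := fun x => by
    refine ⟨lt_max_of_lt_left (by norm_num), max_lt (by norm_num) ?_⟩
    rcases le_total (x - 2 * k) (2 / 3) with hx | hx
    · exact min_lt_of_left_lt (by linarith)
    · exact min_lt_of_right_lt (by linarith)
  set g : ℝ → ℝ := fun y =>
    2 * k + max 0 (min (min (2 / 3) (4 / 3 * (y - 5 / 4))) (8 / 3 - y)) with hg
  have hg1 : ∀ y, y ≤ 5 / 4 ∨ 8 / 3 ≤ y → g y = 2 * k := fun y hy => by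
    simp only [hg]
    rw [max_eq_left, add_zero]
    rcases hy with hy | hy
    · exact min_le_of_left_le (min_le_of_right_le (by linarith))
    · exact min_le_of_right_le (by linarith)
  have hg2 : ∀ y, 5 / 4 ≤ y → y ≤ 7 / 4 → g y = 2 * k + 4 / 3 * (y - 5 / 4) := fun y hy hy' => by
    simp only [hg]
    rw [min_eq_right (a := 2 / 3) (by linarith), min_eq_left (by linarith),
      max_eq_right (by linarith)]
  have hg3 : ∀ y, 7 / 4 ≤ y → y ≤ 2 → g y = 2 * k + 2 / 3 := fun y hy hy' => by
    simp only [hg]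
    rw [min_eq_left (a := 2 / 3) (by linarith), min_eq_left (by linarith),
      max_eq_right (by linarith)]
  have hg4 : ∀ y, 2 * k - 1 / 2 < g y ∧ g y < 2 * k + 1 := fun y => by
    have h1 : max (0 : ℝ) (min (min (2 / 3) (4 / 3 * (y - 5 / 4))) (8 / 3 - y)) < 1 :=
      max_lt (by norm_num) (min_lt_of_left_lt (min_lt_of_left_lt (by norm_num)))
    have h2 : 0 ≤ max (0 : ℝ) (min (min (2 / 3) (4 / 3 * (y - 5 / 4))) (8 / 3 - y)) :=
      le_max_left _ _
    constructor <;> linarith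
  have hfc : Continuous f := by fun_prop
  have hgc : Continuous g := by fun_prop
  clear_value f g
  refine Deforms.trans (P' := fingers (k + 1) ∪ bridge i (2 * k + 2 / 3) (2 * k + 1) ∪
    {p | 2 * k ≤ p.1 ∧ p.1 ≤ 2 * k + 2 / 3 ∧ p.2 ≤ 5 / 4 + 3 / 4 * (p.1 - 2 * k)}) ?_ ?_
  · refine Deforms.of_verticalSlide (lo := 1 / 2) (hi := 2) (a := fun _ => 1) (a' := f)
      continuous_const hfc (fun _ => by norm_num) hf3 (by norm_num) (by norm_num)
      (fun x hx => ?_) fun x y y' hr => ?_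
    · rw [hf1]
      push_cast at hx
      rcases hx with hx | hx
      · left; linarith
      · right; linarith
    · obtain ⟨e1, e2, e3, e4, e5, e6, e7, -⟩ := hr
      by_cases hx : x ≤ 2 * k - 1
      · rw [e7 (hf1 x (Or.inl (by linarith))).symm]
        simp only [Set.mem_union, mem_bridge, Set.mem_ofPred_eq]
        grind
      · have hx' : 2 * k - 1 < x := by linarith
        simp only [Set.mem_union, mem_bridge, Set.mem_ofPred_eq, mem_fingers_succ_of_lt hx']
        have := hf2 x
        grind
  · refine Deforms.of_horizontalSlide (lo := 2 * k - 1 / 2) (hi := 2 * k + 1) (a := g)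
      (a' := fun _ => 2 * k) hgc continuous_const hg4
      (fun _ => by constructor <;> linarith) (by linarith) (by push_cast; linarith)
      (fun y hy => ?_) fun x x' y hr => ?_
    · rw [hg1]
      rcases hy with hy | hy
      · left; linarith
      · right; linarith
    · obtain ⟨e1, e2, e3, e4, e5, e6, e7, -⟩ := hr
      by_cases hx : x ≤ 2 * k - 1 / 2
      · rw [e1 hx]
        simp only [Set.mem_union, mem_bridge, Set.mem_ofPred_eq]
        grind
      · have hx' : 2 * k - 1 < x := by linarith
        have hx'' : 2 * k - 1 < x' := by linarith [e3 (not_le.1 hx)]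
        simp only [Set.mem_union, mem_bridge, Set.mem_ofPred_eq, mem_fingers_succ_of_lt hx',
          mem_fingers_succ_of_lt hx'']
        have h1 := hg1 y
        have h2 := hg2 y
        have h3 := hg3 y
        grind

/-- Neighbouring fingers are at distance 1 from [c, c + 1], so a slide cut off by χ affects a single
finger. -/
theorem exists_bump (c : ℝ) : ∃ χ : ℝ → ℝ, Continuous χ ∧ (∀ x, 0 ≤ χ x) ∧ (∀ x, χ x ≤ 1) ∧
    (∀ x, x ≤ c - 1 / 2 ∨ c + 3 / 2 ≤ x → χ x = 0) ∧ ∀ x, c ≤ x → x ≤ c + 1 → χ x = 1 := by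
  refine ⟨fun x => max 0 (min 1 (min (2 * (x - c) + 1) (3 - 2 * (x - c)))), by fun_prop,
    fun x => le_max_left _ _, fun x => max_le zero_le_one (min_le_left _ _), fun x hx => ?_,
    fun x hx hx' => ?_⟩
  · refine max_eq_left ((min_le_right _ _).trans ?_)
    rcases hx with hx | hx
    · exact (min_le_left _ _).trans (by linarith)
    · exact (min_le_right _ _).trans (by linarith)
  · dsimp only
    rw [min_eq_left (le_min (by linarith) (by linarith)), max_eq_right zero_le_one]

/-- Together with the finger of height 1, the tall loop is a finger of height 3 with a hole between
the heights 1 and 2. The floor of the hole, its ceiling and the top of the finger are lowered in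
this order, so they never collide. This is why a tube between two halves of a disk is a handle. -/
theorem deforms_tallLoop {k : ℕ} {l r : ℝ} (hl : 2 * k < l) (hlr : l < r) (hr : r < 2 * k + 1) :
    Deforms (k + 1) (fingers (k + 1) ∪ tallLoop k l r) (fingers (k + 1) \ hole l r) := by
  have hk : (0 : ℝ) ≤ k := k.cast_nonneg
  obtain ⟨χ, hχc, hχ0, hχ1, hχ2, hχ3⟩ := exists_bump (2 * k)
  -- a finger of height `c` with a hole between the heights `a` and `b`
  let G : ℝ → ℝ → ℝ → Set (ℝ × ℝ) := fun a b c => fingers k ∪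
    {p | 2 * k ≤ p.1 ∧ p.1 ≤ 2 * k + 1 ∧ p.2 ≤ c ∧ ¬ (l < p.1 ∧ p.1 < r ∧ a < p.2 ∧ p.2 < b)}
  have key : ∀ a b c a' b' c' lo hi t t' : ℝ, 0 ≤ lo → hi ≤ 4 → lo < t → t < hi → lo < t' →
      t' < hi → (a = t ∧ a' = t' ∧ b' = b ∧ c' = c ∧ hi ≤ b ∧ hi ≤ c ∨
        b = t ∧ b' = t' ∧ a' = a ∧ c' = c ∧ a ≤ lo ∧ hi ≤ c ∨
        c = t ∧ c' = t' ∧ a' = a ∧ b' = b ∧ a ≤ lo ∧ b ≤ lo) →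
      Deforms (k + 1) (G a b c) (G a' b' c') := by
    intro a b c a' b' c' lo hi t t' hlo hhi h1 h2 h1' h2' habc
    refine Deforms.of_verticalSlide (lo := lo) (hi := hi) (a := fun _ => t)
      (a' := fun x => t + χ x * (t' - t)) continuous_const (by fun_prop) (fun _ => ⟨h1, h2⟩)
      (fun x => lerp_mem ⟨h1, h2⟩ ⟨h1', h2'⟩ (hχ0 x) (hχ1 x)) hlo hhi (fun x hx => ?_)
      fun x y y' hr => ?_
    · push_cast at hx
      rw [hχ2 x (by rcases hx with hx | hx <;> [left; right] <;> linarith)]; ring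
    · obtain ⟨e1, e2, e3, e4, e5, e6, e7, -⟩ := hr
      simp only [G, Set.mem_union, Set.mem_ofPred_eq]
      by_cases hx : x ≤ 2 * k - 1
      · rw [hχ2 x (by left; linarith)] at e7
        rw [e7 (by ring)]
        grind
      · have hx1 : (x, y) ∉ fingers k := fun h => hx (fst_le_of_mem_fingers h)
        have hx2 : (x, y') ∉ fingers k := fun h => hx (fst_le_of_mem_fingers h)
        by_cases hx' : 2 * k ≤ x ∧ x ≤ 2 * k + 1
        · rw [hχ3 x hx'.1 hx'.2] at e5 e6
          have e8 : t + 1 * (t' - t) = t' := by ring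
          rw [e8] at e5 e6
          simp only [hx1, hx2, hx', true_and, false_or]
          grind
        · grind
  have e1 : fingers (k + 1) ∪ tallLoop k l r = G 1 2 3 := by
    ext p
    simp only [G, Set.mem_union, mem_fingers_succ, tallLoop, finger, Set.mem_ofPred_eq]
    grind
  have e2 : fingers (k + 1) \ hole l r = G (1 / 4) (3 / 4) 1 := by
    ext p
    have := fst_le_of_mem_fingers (n := k) (p := p)
    simp only [G, Set.mem_union, Set.mem_sdiff, mem_fingers_succ, hole, finger, Set.mem_ofPred_eq]
    grind
  rw [e1, e2]
  refine (key 1 2 3 (1 / 4) 2 3 0 2 1 (1 / 4) (by norm_num) (by norm_num) (by norm_num)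
    (by norm_num) (by norm_num) (by norm_num) (by norm_num)).trans ?_
  refine (key (1 / 4) 2 3 (1 / 4) (3 / 4) 3 (1 / 4) 3 2 (3 / 4) (by norm_num) (by norm_num)
    (by norm_num) (by norm_num) (by norm_num) (by norm_num) (by norm_num)).trans ?_
  exact key (1 / 4) (3 / 4) 3 (1 / 4) (3 / 4) 1 (3 / 4) 4 3 1 (by norm_num) (by norm_num)
    (by norm_num) (by norm_num) (by norm_num) (by norm_num) (by norm_num)

/-! ### Boxes inside boxes -/

/-- The map that compresses `[c, c + 3]` to `[c, c + 1]`. -/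
noncomputable def compress (c : ℝ) : (ℝ × ℝ) ≃ₜ (ℝ × ℝ) where
  toFun p := (min p.1 (max (c + (p.1 - c) / 3) (p.1 - 2)), p.2)
  invFun p := (max p.1 (min (c + 3 * (p.1 - c)) (p.1 + 2)), p.2)
  left_inv p := by ext <;> grind
  right_inv p := by ext <;> grind
  continuous_toFun := by fun_prop
  continuous_invFun := by fun_prop

/-- The relation between a coordinate and its image under `compress c`. -/
structure CompressRel (c x x' : ℝ) : Prop where
  left : x ≤ c → x' = x
  mid : c ≤ x → x ≤ c + 3 → x' = c + (x - c) / 3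
  right : c + 3 ≤ x → x' = x - 2

theorem compress_rel (c : ℝ) (p : ℝ × ℝ) :
    (compress c p).2 = p.2 ∧ CompressRel c p.1 (compress c p).1 := by
  refine ⟨rfl, ?_⟩
  have : (compress c p).1 = min p.1 (max (c + (p.1 - c) / 3) (p.1 - 2)) := rfl
  rw [this]
  constructor <;> grind

theorem compress_symm_rel (c : ℝ) (p : ℝ × ℝ) :
    ((compress c).symm p).2 = p.2 ∧ CompressRel c ((compress c).symm p).1 p.1 := by
  have := compress_rel c ((compress c).symm p)
  rw [Homeomorph.apply_symm_apply] at this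
  exact ⟨this.1.symm, this.2⟩

/-- The position of the image `(x', y')` of a point `(x, y)` under a map that splits the finger
above `[c, c + 1]` into two fingers. -/
structure SplitRel (c x y x' y' : ℝ) : Prop where
  left : x ≤ c → x' = x
  right : c + 3 ≤ x → x' = x - 2
  mid : c ≤ x → x ≤ c + 3 → c ≤ x' ∧ x' ≤ c + 1
  left_third : c ≤ x → x ≤ c + 7 / 8 → x' = c + (x - c) / 3
  right_third : c + 17 / 8 ≤ x → x ≤ c + 3 → x' = c + (x - c) / 3
  mid_ge : c + 7 / 8 ≤ x → c + 7 / 24 ≤ x'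
  mid_le : x ≤ c + 17 / 8 → x' ≤ c + 17 / 24
  top : 1 < y → c ≤ x → x ≤ c + 3 → x' = c + (x - c) / 3
  snd_eq : x' ≤ c + 1 / 3 ∨ c + 2 / 3 ≤ x' → y' = y
  one_lt : 1 < y → 1 < y'
  two_le : 2 ≤ y → y' = y
  lt_two : y < 2 → y' < 2
  nonneg : 0 ≤ y → 0 ≤ y'
  finger : y ≤ 1 → x ≤ c + 1 ∨ c + 2 ≤ x → y' ≤ 1
  notch : -1 / 4 < y → c + 1 < x → x < c + 2 → 1 < y'

/-- The two horizontal slides turn the gap between the fingers over [c, c + 1] and [c + 2, c + 3]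
into a V-shaped notch of half-width w(y), whose walls form the graph of f. The vertical slide
straightens this graph to height 1, the top of a finger, and the compression by 3 makes one finger
of the whole. The bound w ≥ 1/12 keeps the slides invertible; it takes effect only below y = -1/4,
outside the box. The slides are confined to [c + 7/8, c + 17/8], so they miss the windows of both
fingers, and for y ≥ 1 they are trivial. -/
theorem exists_split (c : ℝ) :
    ∃ ψ : (ℝ × ℝ) ≃ₜ (ℝ × ℝ), ∀ p, SplitRel c p.1 p.2 (ψ p).1 (ψ p).2 := by
  obtain ⟨w, hwc, hw1, hw2, hw3, hw4⟩ : ∃ w : ℝ → ℝ, Continuous w ∧ (∀ y, 1 / 12 ≤ w y) ∧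
      (∀ y, w y ≤ 1 / 2) ∧ (∀ y, y ≤ 1 → (y + 1 / 2) / 3 ≤ w y) ∧
      ∀ y, -1 / 4 ≤ y → w y = min (1 / 2) ((y + 1 / 2) / 3) := by
    refine ⟨fun y => min (1 / 2) (max (1 / 12) ((y + 1 / 2) / 3)), by fun_prop, ?_, ?_, ?_, ?_⟩ <;>
      intros <;> simp only [max_def, min_def] <;> split_ifs <;> linarith
  obtain ⟨f, hfc, hf1, hf2, hf3⟩ : ∃ f : ℝ → ℝ, Continuous f ∧ (∀ x, -1 / 2 ≤ f x ∧ f x ≤ 1) ∧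
      (∀ x, x ≤ c + 1 ∨ c + 2 ≤ x → f x = 1) ∧ ∀ x, c + 1 ≤ x → x ≤ c + 2 →
        f x = max (-1 / 2 + 3 * (c + 3 / 2 - x)) (-1 / 2 + 3 * (x - (c + 3 / 2))) := by
    refine ⟨fun x => min 1 (max (-1 / 2 + 3 * (c + 3 / 2 - x)) (-1 / 2 + 3 * (x - (c + 3 / 2)))),
      by fun_prop, ?_, ?_, ?_⟩
    · intro x
      simp only [max_def, min_def]
      split_ifs <;> constructor <;> linarith
    · intro x hx
      simp only [max_def, min_def]
      rcases hx with hx | hx <;> split_ifs <;> linarith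
    · intro x hx hx'
      simp only [max_def, min_def]
      split_ifs <;> linarith
  obtain ⟨h₁, hh₁⟩ := exists_horizontalSlide (lo := c + 7 / 8) (hi := c + 3 / 2)
    (a := fun _ => c + 1) (a' := fun y => c + 3 / 2 - w y) continuous_const (by fun_prop)
    (fun _ => by constructor <;> linarith)
    (fun y => by constructor <;> linarith [hw1 y, hw2 y])
  obtain ⟨h₂, hh₂⟩ := exists_horizontalSlide (lo := c + 3 / 2) (hi := c + 17 / 8)
    (a := fun _ => c + 2) (a' := fun y => c + 3 / 2 + w y) continuous_const (by fun_prop)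
    (fun _ => by constructor <;> linarith)
    (fun y => by constructor <;> linarith [hw1 y, hw2 y])
  obtain ⟨v, hv⟩ := exists_verticalSlide (lo := -1) (hi := 2) (a := f) (a' := fun _ => 1) hfc
    continuous_const (fun x => by constructor <;> linarith [hf1 x]) (fun _ => by norm_num)
  refine ⟨((h₁.trans h₂).trans v).trans (compress c), fun p => ?_⟩
  simp only [Homeomorph.trans_apply]
  obtain ⟨x, y⟩ := p
  obtain ⟨e1, r1⟩ := hh₁ (x, y)
  generalize h₁ (x, y) = p₁ at *
  obtain ⟨x₁, y₁⟩ := p₁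
  obtain ⟨e2, r2⟩ := hh₂ (x₁, y₁)
  generalize h₂ (x₁, y₁) = p₂ at *
  obtain ⟨x₂, y₂⟩ := p₂
  obtain ⟨e3, r3⟩ := hv (x₂, y₂)
  generalize v (x₂, y₂) = p₃ at *
  obtain ⟨x₃, y₃⟩ := p₃
  obtain ⟨e4, r4⟩ := compress_rel c (x₃, y₃)
  generalize compress c (x₃, y₃) = p₄ at *
  obtain ⟨x₄, y₄⟩ := p₄
  dsimp only at *
  subst e1 e2 e3 e4
  obtain ⟨a1, a2, a3, a4, a5, a6, a7, -⟩ := r1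
  obtain ⟨b1, b2, b3, b4, b5, b6, b7, -⟩ := r2
  obtain ⟨c1, c2, c3, c4, c5, c6, c7, c8⟩ := r3
  obtain ⟨d1, d2, d3⟩ := r4
  have w1 := hw1 y₂
  have w2 := hw2 y₂
  have w3 := hw3 y₂
  have w4 := hw4 y₂
  have f1 := hf1 x₃
  have f2 := hf2 x₃
  have f3 := hf3 x₃
  clear hw1 hw2 hw3 hw4 hf1 hf2 hf3 hh₁ hh₂ hv
  generalize w y₂ = W at *
  generalize f x₃ = F at *
  have k1 : c + 17 / 8 ≤ x → x₃ = x := fun h => by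
    have e := a2 (by linarith)
    rw [b2 (by linarith), e]
  have k2 : x ≤ c + 7 / 8 → x₃ = x := fun h => by
    have e := a1 h
    rw [b1 (by linarith), e]
  have k3 : W = 1 / 2 → x₃ = x := fun h => by
    rw [b7 (by linarith), a7 (by linarith)]
  have k4 : x ≤ c + 1 → x₃ ≤ c + 3 / 2 - W := fun h => by
    have e := a5.1 h
    rwa [b1 (by linarith)]
  have k5 : c + 2 ≤ x → c + 3 / 2 + W ≤ x₃ := fun h => by
    have e := a2 (by linarith)
    exact not_lt.1 fun h' => by linarith [b6.2 h']
  have k6 : c + 1 < x → c + 3 / 2 - W < x₃ := fun h => by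
    have e : c + 3 / 2 - W < x₁ := not_le.1 fun h' => h.not_ge (a5.2 h')
    by_cases h' : x₁ ≤ c + 3 / 2
    · rwa [b1 h']
    · linarith [b3 (not_le.1 h')]
  have k7 : x < c + 2 → x₃ < c + 3 / 2 + W := fun h => b6.1 <| by
    by_cases h' : x < c + 3 / 2
    · linarith [a4 h']
    · rwa [a2 (not_lt.1 h')]
  have k8 : c + 7 / 8 ≤ x → c + 7 / 8 ≤ x₃ := fun h => by
    rcases h.eq_or_lt with rfl | h
    · exact (k2 le_rfl).ge
    · by_cases h' : x ≤ c + 1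
      · have := a5.1 h'
        have := a3 h
        rw [b1 (by linarith)]; linarith
      · linarith [k6 (not_le.1 h')]
  have k9 : x ≤ c + 17 / 8 → x₃ ≤ c + 17 / 8 := fun h => by
    rcases h.eq_or_lt with rfl | h
    · exact (k1 le_rfl).le
    · refine (b4 ?_).le
      by_cases h' : x < c + 3 / 2
      · linarith [a4 h']
      · rwa [a2 (not_lt.1 h')]
  have k10 : 1 ≤ y₂ → W = 1 / 2 := fun h => by
    rw [w4 (by linarith), min_eq_left (by linarith)]
  have k11 : -1 / 4 < y₂ → y₂ ≤ 1 → W = (y₂ + 1 / 2) / 3 := fun h h' => by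
    rw [w4 h.le, min_eq_right (by linarith)]
  have k13 : y₂ ≤ 1 → x ≤ c + 1 ∨ c + 2 ≤ x → y₂ ≤ F := fun h hx => by
    have := w3 h
    by_cases h' : x₃ ≤ c + 1 ∨ c + 2 ≤ x₃
    · rwa [f2 h']
    · rw [not_or, not_le, not_le] at h'
      rw [f3 h'.1.le h'.2.le]
      rcases hx with hx | hx
      · exact le_max_of_le_left (by linarith [k4 hx])
      · exact le_max_of_le_right (by linarith [k5 hx])
  have k14 : -1 / 4 < y₂ → c + 1 < x → x < c + 2 → F < y₂ ∨ 1 < y₂ := fun h hx hx' => by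
    by_cases h1 : y₂ ≤ 1
    · left
      have := k11 h h1
      have := k6 hx
      have := k7 hx'
      rw [f3 (by linarith) (by linarith)]
      exact max_lt (by linarith) (by linarith)
    · exact Or.inr (not_le.1 h1)
  have k15 : x₄ ≤ c + 1 / 3 ∨ c + 2 / 3 ≤ x₄ → F = 1 := fun h => by
    apply f2
    by_contra hx
    rw [not_or, not_le, not_le] at hx
    have := d2 (by linarith) (by linarith)
    rcases h with h | h <;> linarith
  have k16 : x₃ ≤ c + 17 / 8 → x₄ ≤ c + 17 / 24 := fun h => by
    by_cases h' : c ≤ x₃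
    · linarith [d2 h' (by linarith)]
    · linarith [d1 (by linarith)]
  have k17 : c + 7 / 8 ≤ x₃ → c + 7 / 24 ≤ x₄ := fun h => by
    by_cases h' : x₃ ≤ c + 3
    · linarith [d2 (by linarith) h']
    · linarith [d3 (by linarith)]
  exact {
    left := fun h => by
      have e := k2 (by linarith)
      rw [d1 (by linarith), e]
    right := fun h => by
      have e := k1 (by linarith)
      rw [d3 (by linarith), e]
    mid := fun h h' => by
      have e1 : c ≤ x₃ := by
        by_cases hx : x ≤ c + 7 / 8
        · rwa [k2 hx]
        · linarith [k8 (by linarith)]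
      have e2 : x₃ ≤ c + 3 := by
        by_cases hx : x ≤ c + 17 / 8
        · linarith [k9 hx]
        · rwa [k1 (by linarith)]
      have := d2 e1 e2
      constructor <;> linarith
    left_third := fun h h' => by
      have e := k2 h'
      rw [d2 (by linarith) (by linarith), e]
    right_third := fun h h' => by
      have e := k1 h
      rw [d2 (by linarith) (by linarith), e]
    mid_ge := fun h => k17 (k8 h)
    mid_le := fun h => k16 (k9 h)
    top := fun h h1 h2 => by
      have e := k3 (k10 h.le)
      rw [d2 (by linarith) (by linarith), e]
    snd_eq := fun h => c7 (k15 h)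
    one_lt := fun h => not_le.1 fun h' => by linarith [c5.2 h']
    two_le := c2
    lt_two := c4
    nonneg := fun h => h.trans (c8 f1.2)
    finger := fun h h' => c5.1 (k13 h h')
    notch := fun h h1 h2 => not_le.1 fun h' => by
      have := c5.2 h'
      rcases k14 h h1 h2 with h3 | h3 <;> linarith }
theorem SplitRel.eq_of_lt {c x y x' y' : ℝ} (h : SplitRel c x y x' y') (hx : x < c) :
    x' = x ∧ y' = y := by
  have e := h.left hx.le
  exact ⟨e, h.snd_eq (Or.inl (by linarith))⟩

theorem SplitRel.le_of_le {c x y x' y' : ℝ} (h : SplitRel c x y x' y') (hx : c ≤ x) : c ≤ x' := by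
  by_cases h' : x ≤ c + 3
  · exact (h.mid hx h').1
  · linarith [h.right (by linarith)]

/-- The facts are sorted by vertical strips and weakened to linear conditions, a form suited to
automatic comparison of pictures. -/
theorem SplitRel.cases {c x y x' y' : ℝ} (h : SplitRel c x y x' y') (hx : c ≤ x) :
    (x ≤ c + 7 / 8 ∧ x' = c + (x - c) / 3 ∧ y' = y) ∨
    (c + 7 / 8 < x ∧ x ≤ c + 1 ∧ c + 7 / 24 ≤ x' ∧ x' ≤ c + 17 / 24 ∧
      (1 < y ∧ x' = c + (x - c) / 3 ∧ y' = y ∨ y ≤ 1 ∧ y' ≤ 1)) ∨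
    (c + 1 < x ∧ x < c + 2 ∧ c + 7 / 24 ≤ x' ∧ x' ≤ c + 17 / 24 ∧
      (1 < y ∧ x' = c + (x - c) / 3 ∧ 1 < y' ∧ (y < 2 ∧ y' < 2 ∨ 2 ≤ y ∧ y' = y) ∨
        y ≤ 1 ∧ y' < 2 ∧ (y' ≤ 1 ∧ y ≤ -1 / 4 ∨ 1 < y' ∧ c + 1 / 3 < x' ∧ x' < c + 2 / 3))) ∨
    (c + 2 ≤ x ∧ x < c + 17 / 8 ∧ c + 7 / 24 ≤ x' ∧ x' ≤ c + 17 / 24 ∧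
      (1 < y ∧ x' = c + (x - c) / 3 ∧ y' = y ∨ y ≤ 1 ∧ y' ≤ 1)) ∨
    (c + 17 / 8 ≤ x ∧ x ≤ c + 3 ∧ x' = c + (x - c) / 3 ∧ y' = y) ∨
    (c + 3 < x ∧ x' = x - 2 ∧ y' = y) := by
  have hs := h.snd_eq
  by_cases h1 : x ≤ c + 7 / 8
  · have e := h.left_third hx h1
    exact Or.inl ⟨h1, e, hs (Or.inl (by linarith))⟩
  by_cases h6 : c + 3 < x
  · have e := h.right h6.le
    exact Or.inr (Or.inr (Or.inr (Or.inr (Or.inr ⟨h6, e, hs (Or.inr (by linarith))⟩))))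
  by_cases h5 : c + 17 / 8 ≤ x
  · have e := h.right_third h5 (by linarith)
    exact Or.inr (Or.inr (Or.inr (Or.inr (Or.inl ⟨h5, by linarith, e, hs (Or.inr (by linarith))⟩))))
  rw [not_le] at h1 h5
  rw [not_lt] at h6
  have m1 := h.mid_ge h1.le
  have m2 := h.mid_le h5.le
  by_cases h2 : x ≤ c + 1
  · refine Or.inr (Or.inl ⟨h1, h2, m1, m2, ?_⟩)
    by_cases hy : 1 < y
    · have e := h.top hy hx h6
      exact Or.inl ⟨hy, e, hs (Or.inl (by linarith))⟩
    · exact Or.inr ⟨not_lt.1 hy, h.finger (not_lt.1 hy) (Or.inl h2)⟩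
  by_cases h3 : c + 2 ≤ x
  · refine Or.inr (Or.inr (Or.inr (Or.inl ⟨h3, h5, m1, m2, ?_⟩)))
    by_cases hy : 1 < y
    · have e := h.top hy hx h6
      exact Or.inl ⟨hy, e, hs (Or.inr (by linarith))⟩
    · exact Or.inr ⟨not_lt.1 hy, h.finger (not_lt.1 hy) (Or.inr h3)⟩
  rw [not_le] at h2 h3
  refine Or.inr (Or.inr (Or.inl ⟨h2, h3, m1, m2, ?_⟩))
  by_cases hy : 1 < y
  · refine Or.inl ⟨hy, h.top hy hx h6, h.one_lt hy, ?_⟩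
    by_cases hy2 : y < 2
    · exact Or.inl ⟨hy2, h.lt_two hy2⟩
    · exact Or.inr ⟨not_lt.1 hy2, h.two_le (not_lt.1 hy2)⟩
  · rw [not_lt] at hy
    refine Or.inr ⟨hy, h.lt_two (by linarith), ?_⟩
    by_cases hy' : y' ≤ 1
    · exact Or.inl ⟨hy', not_lt.1 fun hlt => (h.notch hlt h2 h3).not_ge hy'⟩
    · rw [not_le] at hy'
      refine Or.inr ⟨hy', not_le.1 fun hle => ?_, not_le.1 fun hle => ?_⟩
      · linarith [hs (Or.inl hle)]
      · linarith [hs (Or.inr hle)]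

/-! ### Tubes and handles seen through a split site. -/

section Split

variable {k : ℕ} {ψ : (ℝ × ℝ) ≃ₜ (ℝ × ℝ)}

theorem mem_fingers_add_two_of_lt {n : ℕ} {x y : ℝ} (h : 2 * n - 1 < x) :
    (x, y) ∈ fingers (n + 2) ↔
      (2 * n ≤ x ∧ x ≤ 2 * n + 1 ∨ 2 * n + 2 ≤ x ∧ x ≤ 2 * n + 3) ∧ y ≤ 1 := by
  rw [mem_fingers_succ, mem_fingers_succ_of_lt h]
  simp only [finger, Set.mem_ofPred_eq]
  push_cast
  grind

theorem mem_fingers_add_two_iff_of_lt {n : ℕ} {x y : ℝ} (h : x < 2 * n) :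
    (x, y) ∈ fingers (n + 2) ↔ (x, y) ∈ fingers (n + 1) := by
  rw [mem_fingers_succ, or_iff_left]
  intro h'
  have h1 : 2 * ((n + 1 : ℕ) : ℝ) ≤ x := h'.1
  push_cast at h1
  linarith

theorem mem_fingers_of_mem {n i : ℕ} (h : i < n) {x y : ℝ} (h1 : 2 * i ≤ x) (h2 : x ≤ 2 * i + 1)
    (h3 : y ≤ 1) : (x, y) ∈ fingers n := ⟨i, h, h1, h2, h3⟩

/-- To restrict a planar picture along a split, it is enough to compare the two pictures to the
left of the split finger, and to compare them near the split finger in terms of coordinates. -/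
theorem restrictsTo_split (hψ : ∀ p, SplitRel (2 * k) p.1 p.2 (ψ p).1 (ψ p).2)
    {P P' : Set (ℝ × ℝ)}
    (h1 : ∀ x y : ℝ, x < 2 * k → ((x, y) ∈ P ↔ (x, y) ∈ P'))
    (h2 : ∀ x y : ℝ, x < 2 * k → (x < -1 ∨ y < 0 ∨ 4 < y) → ((x, y) ∈ P ↔ (x, y) ∈ fingers (k + 1)))
    (h3 : ∀ x y x' y' : ℝ, 2 * k ≤ x → 2 * k ≤ x' → -1 / 4 < y → SplitRel (2 * k) x y x' y' →
      ((x', y') ∈ P ↔ (x, y) ∈ P'))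
    (h4 : ∀ x y x' y' : ℝ, 2 * k ≤ x → 2 * k ≤ x' → SplitRel (2 * k) x y x' y' →
      2 * k + 4 < x ∨ y < 0 ∨ 4 < y → ((x', y') ∈ P ↔ x' ≤ 2 * k + 1 ∧ y' ≤ 1)) :
    RestrictsTo (k + 1) (k + 2) {u | -1 / 4 < u.2} ψ P P' := by
  have hk : (0 : ℝ) ≤ k := k.cast_nonneg
  constructor
  · rintro ⟨x, y⟩ hu
    have hr := hψ (x, y)
    by_cases hx : x < 2 * k
    · rw [show ψ (x, y) = (x, y) from Prod.ext (hr.eq_of_lt hx).1 (hr.eq_of_lt hx).2]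
      exact h1 x y hx
    · exact h3 x y _ _ (not_lt.1 hx) (hr.le_of_le (not_lt.1 hx)) hu hr
  · rintro ⟨x, y⟩ hu
    have hr := hψ (x, y)
    have hu' : x < -1 ∨ 2 * k + 4 < x ∨ y < 0 ∨ 4 < y := by
      by_contra hc
      push Not at hc
      refine hu ⟨⟨hc.1, ?_⟩, hc.2.2⟩
      push_cast
      linarith [hc.2.1]
    by_cases hx : x < 2 * k
    · rw [show ψ (x, y) = (x, y) from Prod.ext (hr.eq_of_lt hx).1 (hr.eq_of_lt hx).2]
      refine h2 x y hx ?_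
      rcases hu' with h | h | h
      · exact Or.inl h
      · linarith
      · exact Or.inr h
    · have hx' := hr.le_of_le (not_lt.1 hx)
      rw [show ψ (x, y) = ((ψ (x, y)).1, (ψ (x, y)).2) from rfl,
        mem_fingers_succ_of_lt (by linarith)]
      rw [h4 x y _ _ (not_lt.1 hx) hx' hr]
      · simp [hx']
      · rcases hu' with h | h
        · linarith
        · exact h

theorem isSubbox_split (hψ : ∀ p, SplitRel (2 * k) p.1 p.2 (ψ p).1 (ψ p).2) :
    IsSubbox (k + 1) (k + 2) {u | -1 / 4 < u.2} ψ := by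
  have hk : (0 : ℝ) ≤ k := k.cast_nonneg
  refine ⟨isOpen_lt continuous_const continuous_snd, fun u hu => ?_, fun u hu => ?_,
    -- The fingers themselves are treated as a planar picture that restricts along the split.
    (restrictsTo_split hψ (P := fingers (k + 1)) ?_ ?_ ?_ ?_).1⟩
  · have := hu.2.1
    simp only [Set.mem_ofPred_eq]
    linarith
  · obtain ⟨⟨u1, u2⟩, u3, u4⟩ := hu
    push_cast at u2
    have hr := hψ u
    have h0 := hr.nonneg u3
    have h4 : (ψ u).2 ≤ 4 := by
      by_cases h : u.2 < 2
      · linarith [hr.lt_two h]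
      · rwa [hr.two_le (not_lt.1 h)]
    refine ⟨?_, h0, h4⟩
    push_cast
    by_cases hx : u.1 < 2 * k
    · rw [(hr.eq_of_lt hx).1]
      constructor <;> linarith
    · have := hr.le_of_le (not_lt.1 hx)
      by_cases hx' : u.1 ≤ 2 * k + 3
      · have := hr.mid (not_lt.1 hx) hx'
        constructor <;> linarith
      · have := hr.right (by linarith)
        constructor <;> linarith
  · intro x y hx
    exact (mem_fingers_add_two_iff_of_lt hx).symm
  · intro x y _ _
    exact Iff.rfl
  · intro x y x' y' hx hx' hy hr
    have := hr.cases hx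
    rw [mem_fingers_succ_of_lt (by linarith), mem_fingers_add_two_of_lt (by linarith)]
    clear hr hψ
    grind
  · intro x y x' y' hx hx' hr hy
    rw [mem_fingers_succ_of_lt (by linarith)]
    simp [hx']

theorem mem_tallLoop {l r x y : ℝ} : (x, y) ∈ tallLoop k l r ↔
    2 * k ≤ x ∧ x ≤ 2 * k + 1 ∧ y ≤ 3 ∧ ¬ (l < x ∧ x < r ∧ y < 2) := Iff.rfl

theorem mem_hole {l r x y : ℝ} : (x, y) ∈ hole l r ↔
    l < x ∧ x < r ∧ 1 / 4 < y ∧ y < 3 / 4 := Iff.rfl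

theorem restrictsTo_split_arch (hψ : ∀ p, SplitRel (2 * k) p.1 p.2 (ψ p).1 (ψ p).2) {i j : ℕ}
    (hi : i < j) (hj : j < k) :
    RestrictsTo (k + 1) (k + 2) {u | -1 / 4 < u.2} ψ
      (fingers (k + 1) ∪ arch i j) (fingers (k + 2) ∪ arch i j) := by
  have hk : (0 : ℝ) ≤ k := k.cast_nonneg
  have hik : (i : ℝ) + 1 ≤ j := by exact_mod_cast hi
  have hjk : (j : ℝ) + 1 ≤ k := by exact_mod_cast hj
  refine restrictsTo_split hψ ?_ ?_ ?_ ?_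
  · intro x y hx
    simp only [Set.mem_union, mem_bridge, arch_eq_bridge,
      mem_fingers_add_two_iff_of_lt hx]
  · intro x y hx hxy
    have hf := mem_fingers_of_mem (n := k + 1) (i := i) (x := x) (y := y) (by omega)
    have hf' := mem_fingers_of_mem (n := k + 1) (i := j) (x := x) (y := y) (by omega)
    simp only [Set.mem_union, mem_bridge, arch_eq_bridge]
    grind
  · intro x y x' y' hx hx' hy hr
    have := hr.cases hx
    simp only [Set.mem_union, mem_bridge, arch_eq_bridge]
    rw [mem_fingers_succ_of_lt (by linarith), mem_fingers_add_two_of_lt (by linarith)]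
    clear hr hψ
    grind
  · intro x y x' y' hx hx' hr hy
    have := hr.cases hx
    simp only [Set.mem_union, mem_bridge, arch_eq_bridge]
    rw [mem_fingers_succ_of_lt (by linarith)]
    clear hr hψ
    grind

/-- Above the fingers the split is mere compression by 3, so a leg over the left half is a leg over
the left third of the original finger. -/
theorem restrictsTo_split_arch_left (hψ : ∀ p, SplitRel (2 * k) p.1 p.2 (ψ p).1 (ψ p).2) {i : ℕ}
    (hi : i < k) :
    RestrictsTo (k + 1) (k + 2) {u | -1 / 4 < u.2} ψ
      (fingers (k + 1) ∪ bridge i (2 * k) (2 * k + 1 / 3)) (fingers (k + 2) ∪ arch i k) := by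
  have hk : (0 : ℝ) ≤ k := k.cast_nonneg
  have hik : (i : ℝ) + 1 ≤ k := by exact_mod_cast hi
  refine restrictsTo_split hψ ?_ ?_ ?_ ?_
  · intro x y hx
    simp only [Set.mem_union, mem_bridge, arch_eq_bridge,
      mem_fingers_add_two_iff_of_lt hx]
    grind
  · intro x y hx hxy
    have hf := mem_fingers_of_mem (n := k + 1) (i := i) (x := x) (y := y) (by omega)
    simp only [Set.mem_union, mem_bridge]
    grind
  · intro x y x' y' hx hx' hy hr
    have := hr.cases hx
    simp only [Set.mem_union, mem_bridge, arch_eq_bridge]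
    rw [mem_fingers_succ_of_lt (by linarith), mem_fingers_add_two_of_lt (by linarith)]
    clear hr hψ
    grind
  · intro x y x' y' hx hx' hr hy
    have := hr.cases hx
    simp only [Set.mem_union, mem_bridge]
    rw [mem_fingers_succ_of_lt (by linarith)]
    clear hr hψ
    grind

theorem restrictsTo_split_arch_right (hψ : ∀ p, SplitRel (2 * k) p.1 p.2 (ψ p).1 (ψ p).2) {i : ℕ}
    (hi : i < k) :
    RestrictsTo (k + 1) (k + 2) {u | -1 / 4 < u.2} ψ
      (fingers (k + 1) ∪ bridge i (2 * k + 2 / 3) (2 * k + 1))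
      (fingers (k + 2) ∪ arch i (k + 1)) := by
  have hk : (0 : ℝ) ≤ k := k.cast_nonneg
  have hik : (i : ℝ) + 1 ≤ k := by exact_mod_cast hi
  refine restrictsTo_split hψ ?_ ?_ ?_ ?_
  · intro x y hx
    simp only [Set.mem_union, mem_bridge, arch_eq_bridge,
      mem_fingers_add_two_iff_of_lt hx]
    push_cast
    grind
  · intro x y hx hxy
    have hf := mem_fingers_of_mem (n := k + 1) (i := i) (x := x) (y := y) (by omega)
    simp only [Set.mem_union, mem_bridge]
    grind
  · intro x y x' y' hx hx' hy hr
    have := hr.cases hx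
    simp only [Set.mem_union, mem_bridge, arch_eq_bridge]
    rw [mem_fingers_succ_of_lt (by linarith), mem_fingers_add_two_of_lt (by linarith)]
    push_cast
    clear hr hψ
    grind
  · intro x y x' y' hx hx' hr hy
    have := hr.cases hx
    simp only [Set.mem_union, mem_bridge]
    rw [mem_fingers_succ_of_lt (by linarith)]
    clear hr hψ
    grind

/-- The arch between the halves stands on the outer thirds of the original finger, and its opening
lies above the middle third. The floor of that opening is the top of the original finger, just
outside the new box. -/
theorem restrictsTo_split_tallLoop (hψ : ∀ p, SplitRel (2 * k) p.1 p.2 (ψ p).1 (ψ p).2) :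
    RestrictsTo (k + 1) (k + 2) {u | -1 / 4 < u.2} ψ
      (fingers (k + 1) ∪ tallLoop k (2 * k + 1 / 3) (2 * k + 2 / 3))
      (fingers (k + 2) ∪ arch k (k + 1)) := by
  have hk : (0 : ℝ) ≤ k := k.cast_nonneg
  refine restrictsTo_split hψ ?_ ?_ ?_ ?_
  · intro x y hx
    simp only [Set.mem_union, mem_bridge, mem_tallLoop, arch_eq_bridge,
      mem_fingers_add_two_iff_of_lt hx]
    push_cast
    grind
  · intro x y hx hxy
    simp only [Set.mem_union, mem_tallLoop]
    grind
  · intro x y x' y' hx hx' hy hr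
    have := hr.cases hx
    simp only [Set.mem_union, mem_bridge, mem_tallLoop, arch_eq_bridge]
    rw [mem_fingers_succ_of_lt (by linarith), mem_fingers_add_two_of_lt (by linarith)]
    push_cast
    clear hr hψ
    grind
  · intro x y x' y' hx hx' hr hy
    have := hr.cases hx
    simp only [Set.mem_union, mem_tallLoop]
    rw [mem_fingers_succ_of_lt (by linarith)]
    clear hr hψ
    grind

theorem restrictsTo_split_window (hψ : ∀ p, SplitRel (2 * k) p.1 p.2 (ψ p).1 (ψ p).2) {i : ℕ}
    (hi : i < k) :
    RestrictsTo (k + 1) (k + 2) {u | -1 / 4 < u.2} ψ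
      (fingers (k + 1) \ window i) (fingers (k + 2) \ window i) := by
  have hk : (0 : ℝ) ≤ k := k.cast_nonneg
  have hik : (i : ℝ) + 1 ≤ k := by exact_mod_cast hi
  refine restrictsTo_split hψ ?_ ?_ ?_ ?_
  · intro x y hx
    simp only [Set.mem_sdiff, mem_hole, window_eq_hole, mem_fingers_add_two_iff_of_lt hx]
  · intro x y hx hxy
    simp only [Set.mem_sdiff, mem_hole, window_eq_hole]
    grind
  · intro x y x' y' hx hx' hy hr
    have := hr.cases hx
    simp only [Set.mem_sdiff, mem_hole, window_eq_hole]
    rw [mem_fingers_succ_of_lt (by linarith), mem_fingers_add_two_of_lt (by linarith)]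
    clear hr hψ
    grind
  · intro x y x' y' hx hx' hr hy
    have := hr.cases hx
    simp only [Set.mem_sdiff, mem_hole, window_eq_hole]
    rw [mem_fingers_succ_of_lt (by linarith)]
    clear hr hψ
    grind

/-- The constants are those of the window, 1/4 and 3/4, divided by 3. For the right half they are
9/4 and 11/4 divided by 3. -/
theorem restrictsTo_split_hole_left (hψ : ∀ p, SplitRel (2 * k) p.1 p.2 (ψ p).1 (ψ p).2) :
    RestrictsTo (k + 1) (k + 2) {u | -1 / 4 < u.2} ψ
      (fingers (k + 1) \ hole (2 * k + 1 / 12) (2 * k + 1 / 4)) (fingers (k + 2) \ window k) := by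
  have hk : (0 : ℝ) ≤ k := k.cast_nonneg
  refine restrictsTo_split hψ ?_ ?_ ?_ ?_
  · intro x y hx
    simp only [Set.mem_sdiff, mem_hole, window_eq_hole, mem_fingers_add_two_iff_of_lt hx]
    grind
  · intro x y hx hxy
    simp only [Set.mem_sdiff, mem_hole]
    grind
  · intro x y x' y' hx hx' hy hr
    have := hr.cases hx
    simp only [Set.mem_sdiff, mem_hole, window_eq_hole]
    rw [mem_fingers_succ_of_lt (by linarith), mem_fingers_add_two_of_lt (by linarith)]
    clear hr hψ
    grind
  · intro x y x' y' hx hx' hr hy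
    have := hr.cases hx
    simp only [Set.mem_sdiff, mem_hole]
    rw [mem_fingers_succ_of_lt (by linarith)]
    clear hr hψ
    grind

theorem restrictsTo_split_hole_right (hψ : ∀ p, SplitRel (2 * k) p.1 p.2 (ψ p).1 (ψ p).2) :
    RestrictsTo (k + 1) (k + 2) {u | -1 / 4 < u.2} ψ
      (fingers (k + 1) \ hole (2 * k + 3 / 4) (2 * k + 11 / 12))
      (fingers (k + 2) \ window (k + 1)) := by
  have hk : (0 : ℝ) ≤ k := k.cast_nonneg
  refine restrictsTo_split hψ ?_ ?_ ?_ ?_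
  · intro x y hx
    simp only [Set.mem_sdiff, mem_hole, window_eq_hole, mem_fingers_add_two_iff_of_lt hx]
    push_cast
    grind
  · intro x y hx hxy
    simp only [Set.mem_sdiff, mem_hole]
    grind
  · intro x y x' y' hx hx' hy hr
    have := hr.cases hx
    simp only [Set.mem_sdiff, mem_hole, window_eq_hole]
    rw [mem_fingers_succ_of_lt (by linarith), mem_fingers_add_two_of_lt (by linarith)]
    push_cast
    clear hr hψ
    grind
  · intro x y x' y' hx hx' hr hy
    have := hr.cases hx
    simp only [Set.mem_sdiff, mem_hole]
    rw [mem_fingers_succ_of_lt (by linarith)]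
    clear hr hψ
    grind

end Split

/-! ### Reflection, and boxes that select some of three or four sites. -/

theorem mem_fingers_two {x y : ℝ} : (x, y) ∈ fingers 2 ↔
    (0 ≤ x ∧ x ≤ 1 ∨ 2 ≤ x ∧ x ≤ 3) ∧ y ≤ 1 := by
  have h0 : (x, y) ∉ fingers 0 := fun ⟨k, hk, _⟩ => Nat.not_lt_zero k hk
  have h1 := mem_fingers_succ (n := 0) (p := (x, y))
  have h2 := mem_fingers_succ (n := 1) (p := (x, y))
  simp only [finger, Set.mem_ofPred_eq, zero_add, Nat.reduceAdd, Nat.cast_zero, Nat.cast_one]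
    at h1 h2
  grind

theorem mem_fingers_three {x y : ℝ} : (x, y) ∈ fingers 3 ↔
    (0 ≤ x ∧ x ≤ 1 ∨ 2 ≤ x ∧ x ≤ 3 ∨ 4 ≤ x ∧ x ≤ 5) ∧ y ≤ 1 := by
  have h1 := mem_fingers_succ (n := 2) (p := (x, y))
  rw [mem_fingers_two] at h1
  simp only [finger, Set.mem_ofPred_eq, Nat.reduceAdd, Nat.cast_ofNat] at h1
  grind

theorem mem_fingers_four {x y : ℝ} : (x, y) ∈ fingers 4 ↔
    (0 ≤ x ∧ x ≤ 1 ∨ 2 ≤ x ∧ x ≤ 3 ∨ 4 ≤ x ∧ x ≤ 5 ∨ 6 ≤ x ∧ x ≤ 7) ∧ y ≤ 1 := by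
  have h1 := mem_fingers_succ (n := 3) (p := (x, y))
  rw [mem_fingers_three] at h1
  simp only [finger, Set.mem_ofPred_eq, Nat.reduceAdd, Nat.cast_ofNat] at h1
  grind

theorem mem_arch {i j : ℕ} {x y : ℝ} : (x, y) ∈ arch i j ↔
    2 * i ≤ x ∧ x ≤ 2 * j + 1 ∧ y ≤ 3 ∧ ¬ (2 * i + 1 < x ∧ x < 2 * j ∧ y < 2) := Iff.rfl

/-- The reflection that reverses the order of three sites. -/
def reflection : (ℝ × ℝ) ≃ₜ (ℝ × ℝ) where
  toFun p := (5 - p.1, p.2)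
  invFun p := (5 - p.1, p.2)
  left_inv p := by simp
  right_inv p := by simp
  continuous_toFun := by fun_prop
  continuous_invFun := by fun_prop

theorem reflection_apply (x y : ℝ) : reflection (x, y) = (5 - x, y) := rfl

theorem isSubbox_reflection : IsSubbox 3 3 Set.univ reflection := by
  refine ⟨isOpen_univ, Set.subset_univ _, fun ⟨x, y⟩ hu => ?_, fun ⟨x, y⟩ _ => ?_⟩
  · rw [reflection_apply]
    simp only [mem_planarBox] at hu ⊢
    push_cast at hu ⊢
    grind
  · rw [reflection_apply, mem_fingers_three, mem_fingers_three]
    grind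

theorem restrictsTo_reflection_arch_zero_one : RestrictsTo 3 3 Set.univ reflection
    (fingers 3 ∪ arch 0 1) (fingers 3 ∪ arch 1 2) := by
  constructor <;> rintro ⟨x, y⟩ hu <;>
    simp only [reflection_apply, Set.mem_union, mem_fingers_three, mem_arch,
      mem_planarBox] at hu ⊢ <;>
    push_cast at hu ⊢ <;> grind

theorem restrictsTo_reflection_arch_zero_two : RestrictsTo 3 3 Set.univ reflection
    (fingers 3 ∪ arch 0 2) (fingers 3 ∪ arch 0 2) := by
  constructor <;> rintro ⟨x, y⟩ hu <;>
    simp only [reflection_apply, Set.mem_union, mem_fingers_three, mem_arch,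
      mem_planarBox] at hu ⊢ <;>
    push_cast at hu ⊢ <;> grind

theorem restrictsTo_reflection_arch_one_two : RestrictsTo 3 3 Set.univ reflection
    (fingers 3 ∪ arch 1 2) (fingers 3 ∪ arch 0 1) := by
  constructor <;> rintro ⟨x, y⟩ hu <;>
    simp only [reflection_apply, Set.mem_union, mem_fingers_three, mem_arch,
      mem_planarBox] at hu ⊢ <;>
    push_cast at hu ⊢ <;> grind

theorem restrictsTo_reflection_window_zero : RestrictsTo 3 3 Set.univ reflection
    (fingers 3 \ window 0) (fingers 3 \ window 2) := by
  constructor <;> rintro ⟨x, y⟩ hu <;>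
    simp only [reflection_apply, Set.mem_sdiff, mem_fingers_three, window_eq_hole, mem_hole,
      mem_planarBox] at hu ⊢ <;>
    push_cast at hu ⊢ <;> grind

/-- The box around the last two of three sites. -/
theorem exists_lastTwo : ∃ ψ, IsSubbox 3 2 {u | -3 / 2 < u.1} ψ ∧
    RestrictsTo 3 2 {u | -3 / 2 < u.1} ψ (fingers 3 ∪ arch 1 2) (fingers 2 ∪ arch 0 1) ∧
    RestrictsTo 3 2 {u | -3 / 2 < u.1} ψ (fingers 3 \ window 1) (fingers 2 \ window 0) ∧
    RestrictsTo 3 2 {u | -3 / 2 < u.1} ψ (fingers 3 \ window 2) (fingers 2 \ window 1) := by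
  -- After translation by 2 the left bound -3/2 of the open set lies at 1/2, inside finger 0.
  -- Sliding it to 5/4 clears that finger, while the sites 1 and 2, at x ≥ 2, stay fixed.
  obtain ⟨h, hh⟩ := exists_horizontalSlide (lo := 0) (hi := 2) (a := fun _ => 1 / 2)
    (a' := fun _ => 5 / 4) continuous_const continuous_const (fun _ => by norm_num)
    (fun _ => by norm_num)
  obtain ⟨ψ, hψ⟩ : ∃ ψ : (ℝ × ℝ) ≃ₜ (ℝ × ℝ), ∀ x y, ∃ x', ψ (x, y) = (x', y) ∧
      (0 ≤ x → x' = x + 2) ∧ (x < 0 → x' < 2) ∧ (-3 / 2 < x → 5 / 4 < x') ∧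
      (x ≤ -3 / 2 → x' ≤ 5 / 4) := by
    refine ⟨(Homeomorph.prodCongr (Homeomorph.addRight 2) (Homeomorph.refl ℝ)).trans h,
      fun x y => ?_⟩
    obtain ⟨e, hr⟩ := hh (x + 2, y)
    refine ⟨(h (x + 2, y)).1, Prod.ext rfl e, fun hx => hr.of_ge (by simp only; linarith),
      fun hx => hr.lt_hi (by simp only; linarith), fun hx => not_le.1 fun h' => ?_,
      fun hx => hr.le_iff.1 (by simp only; linarith)⟩
    have := hr.le_iff.2 h'
    simp only at this
    linarith
  refine ⟨ψ, ⟨isOpen_lt continuous_const continuous_fst, fun ⟨x, y⟩ hu => ?_,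
    fun ⟨x, y⟩ hu => ?_, fun ⟨x, y⟩ hu => ?_⟩, ⟨fun ⟨x, y⟩ hu => ?_, fun ⟨x, y⟩ hu => ?_⟩,
    ⟨fun ⟨x, y⟩ hu => ?_, fun ⟨x, y⟩ hu => ?_⟩, ⟨fun ⟨x, y⟩ hu => ?_, fun ⟨x, y⟩ hu => ?_⟩⟩
  all_goals
    obtain ⟨x', e, h1, h2, h3, h4⟩ := hψ x y
    simp only [e, Set.mem_union, Set.mem_sdiff, Set.mem_ofPred_eq, mem_fingers_three,
      mem_fingers_two, mem_arch, window_eq_hole, mem_hole, mem_planarBox] at hu ⊢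
    push_cast at hu ⊢
    clear e hψ hh
    grind

/-- A box that contains all but one of four sites: it is stretched at the missing site `j`, and
its floor passes above that site. -/
theorem exists_skip (j : ℕ) : ∃ ψ : (ℝ × ℝ) ≃ₜ (ℝ × ℝ), ∀ x y, ∃ x' y', ψ (x, y) = (x', y') ∧
    CompressRel (2 * j - 1) x' x ∧
    (x' ≤ 2 * j - 1 / 2 ∨ 2 * j + 3 / 2 ≤ x' → y' = y) ∧ (2 ≤ y → y' = y) ∧ (y < 2 → y' < 2) ∧
    (0 ≤ y → 0 ≤ y') ∧ (2 * j ≤ x' → x' ≤ 2 * j + 1 → -1 / 4 < y → 1 < y') := by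
  obtain ⟨χ, hχc, hχ0, hχ1, hχ2, hχ3⟩ := exists_bump (2 * j)
  -- Undoing a compression makes room for the missing site; over it the level -1/4 is then raised to
  -- 5/4, above the finger top 1 and below the ceiling 2 of the arches.
  obtain ⟨v, hv⟩ := exists_verticalSlide (lo := -1) (hi := 2) (a := fun _ => -1 / 4)
    (a' := fun x => -1 / 4 + χ x * (5 / 4 - -1 / 4)) continuous_const (by fun_prop)
    (fun _ => by norm_num)
    (fun x => lerp_mem (by norm_num) (by norm_num) (hχ0 x) (hχ1 x))
  refine ⟨(compress (2 * j - 1)).symm.trans v, fun x y => ?_⟩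
  obtain ⟨e1, r1⟩ := compress_symm_rel (2 * j - 1) (x, y)
  set p := (compress (2 * j - 1)).symm (x, y) with hp
  obtain ⟨e2, r2⟩ := hv p
  rw [e1] at r2
  refine ⟨p.1, (v p).2, Prod.ext e2 rfl, r1, fun h => r2.of_eq ?_, r2.of_ge, r2.lt_hi,
    fun h => h.trans (r2.le_of_le ?_), fun h h' hy => not_le.1 fun h1 => ?_⟩
  · rw [hχ2 _ h]; ring
  · linarith [mul_nonneg (hχ0 p.1) (show (0 : ℝ) ≤ 5 / 4 - -1 / 4 by norm_num)]
  · have := r2.le_iff.2 (by rw [hχ3 _ h h']; linarith)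
    simp only at this
    linarith

/-- The box around the sites `0`, `2`, `3` of four sites. -/
theorem exists_skip_one : ∃ ψ, IsSubbox 4 3 {u | -1 / 4 < u.2} ψ ∧
    RestrictsTo 4 3 {u | -1 / 4 < u.2} ψ (fingers 4 ∪ arch 0 2) (fingers 3 ∪ arch 0 1) ∧
    RestrictsTo 4 3 {u | -1 / 4 < u.2} ψ (fingers 4 ∪ arch 0 3) (fingers 3 ∪ arch 0 2) ∧
    RestrictsTo 4 3 {u | -1 / 4 < u.2} ψ (fingers 4 ∪ arch 2 3) (fingers 3 ∪ arch 1 2) ∧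
    RestrictsTo 4 3 {u | -1 / 4 < u.2} ψ (fingers 4 \ window 0) (fingers 3 \ window 0) := by
  obtain ⟨ψ, hψ⟩ := exists_skip 1
  refine ⟨ψ, ⟨isOpen_lt continuous_const continuous_snd, fun ⟨x, y⟩ hu => ?_,
    fun ⟨x, y⟩ hu => ?_, fun ⟨x, y⟩ hu => ?_⟩, ⟨fun ⟨x, y⟩ hu => ?_, fun ⟨x, y⟩ hu => ?_⟩,
    ⟨fun ⟨x, y⟩ hu => ?_, fun ⟨x, y⟩ hu => ?_⟩, ⟨fun ⟨x, y⟩ hu => ?_, fun ⟨x, y⟩ hu => ?_⟩,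
    ⟨fun ⟨x, y⟩ hu => ?_, fun ⟨x, y⟩ hu => ?_⟩⟩
  all_goals
    obtain ⟨x', y', e, ⟨c1, c2, c3⟩, h1, h2, h3, h4, h5⟩ := hψ x y
    simp only [e, Set.mem_union, Set.mem_sdiff, Set.mem_ofPred_eq, mem_fingers_three,
      mem_fingers_four, mem_arch, window_eq_hole, mem_hole, mem_planarBox] at hu ⊢
    push_cast at *
    clear e hψ
    rcases le_or_gt x' 1 with hx | hx
    · grind
    rcases le_or_gt x' 4 with hx' | hx'
    · grind
    · grind

/-- The box around the sites `0`, `1`, `3` of four sites. -/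
theorem exists_skip_two : ∃ ψ, IsSubbox 4 3 {u | -1 / 4 < u.2} ψ ∧
    RestrictsTo 4 3 {u | -1 / 4 < u.2} ψ (fingers 4 ∪ arch 0 1) (fingers 3 ∪ arch 0 1) ∧
    RestrictsTo 4 3 {u | -1 / 4 < u.2} ψ (fingers 4 ∪ arch 0 3) (fingers 3 ∪ arch 0 2) ∧
    RestrictsTo 4 3 {u | -1 / 4 < u.2} ψ (fingers 4 ∪ arch 1 3) (fingers 3 ∪ arch 1 2) ∧
    RestrictsTo 4 3 {u | -1 / 4 < u.2} ψ (fingers 4 \ window 0) (fingers 3 \ window 0) := by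
  obtain ⟨ψ, hψ⟩ := exists_skip 2
  refine ⟨ψ, ⟨isOpen_lt continuous_const continuous_snd, fun ⟨x, y⟩ hu => ?_,
    fun ⟨x, y⟩ hu => ?_, fun ⟨x, y⟩ hu => ?_⟩, ⟨fun ⟨x, y⟩ hu => ?_, fun ⟨x, y⟩ hu => ?_⟩,
    ⟨fun ⟨x, y⟩ hu => ?_, fun ⟨x, y⟩ hu => ?_⟩, ⟨fun ⟨x, y⟩ hu => ?_, fun ⟨x, y⟩ hu => ?_⟩,
    ⟨fun ⟨x, y⟩ hu => ?_, fun ⟨x, y⟩ hu => ?_⟩⟩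
  all_goals
    obtain ⟨x', y', e, ⟨c1, c2, c3⟩, h1, h2, h3, h4, h5⟩ := hψ x y
    simp only [e, Set.mem_union, Set.mem_sdiff, Set.mem_ofPred_eq, mem_fingers_three,
      mem_fingers_four, mem_arch, window_eq_hole, mem_hole, mem_planarBox] at hu ⊢
    push_cast at *
    clear e hψ
    rcases le_or_gt x' 3 with hx | hx
    · grind
    rcases le_or_gt x' 6 with hx' | hx'
    · grind
    · grind

/-! ### Existence of handles and of the missing tube. -/

section Existence

variable {B : Finset Circle} {O O' : Smoothing B} {C C' : Cobordism O O'}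
  {φ : (ℝ × ℝ) × ℝ → Cylinder} {n i : ℕ}

theorem Cobordism.HasDisks.planarFlat (hC : C.HasDisks φ n) {p : ℝ × ℝ}
    (hp : p ∈ openPlanarBox n) : PlanarFlat (fingers n) p := by
  have h : C.IsReplacement φ n (thickSurface (fingers n)) C :=
    Cobordism.isReplacement_of (fun x hx => hC.mem_iff hx) fun _ _ => Iff.rfl
  exact h.planarFlat hC.1 hp

theorem snd_le_of_mem_fingers {x y : ℝ} (h : (x, y) ∈ fingers n) : y ≤ 1 := by
  obtain ⟨k, -, h⟩ := h
  exact h.2.2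

theorem mem_window {x y : ℝ} : (x, y) ∈ window i ↔
    2 * i + 1 / 4 < x ∧ x < 2 * i + 3 / 4 ∧ 1 / 4 < y ∧ y < 3 / 4 := Iff.rfl

/-- Away from the frame of a window, cutting the window out has no effect. -/
theorem eventually_mem_sdiff_window {p : ℝ × ℝ}
    (hp : ¬ ((2 * i + 1 / 4 ≤ p.1 ∧ p.1 ≤ 2 * i + 3 / 4) ∧ 1 / 4 ≤ p.2 ∧ p.2 ≤ 3 / 4)) :
    ∀ᶠ q in 𝓝 p, q ∈ fingers n \ window i ↔ q ∈ fingers n := by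
  have h : IsClosed
      (Set.Icc (2 * (i : ℝ) + 1 / 4) (2 * i + 3 / 4) ×ˢ Set.Icc (1 / 4 : ℝ) (3 / 4)) :=
    isClosed_Icc.prod isClosed_Icc
  filter_upwards [h.isOpen_compl.mem_nhds hp] with q hq
  refine and_iff_left fun hw => hq ?_
  exact ⟨⟨hw.1.le, hw.2.1.le⟩, hw.2.2.1.le, hw.2.2.2.le⟩

/-- An affine change of coordinates that stretches the first coordinate by a factor `2`, and
translates the second one after multiplication by a sign. -/
noncomputable def stretch (a b : ℝ) (s : ℤˣ) : (ℝ × ℝ) ≃ₜ (ℝ × ℝ) where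
  toFun p := (2 * p.1 + a, (s : ℤ) * p.2 + b)
  invFun p := ((p.1 - a) / 2, (s : ℤ) * (p.2 - b))
  left_inv p := by rcases Int.units_eq_one_or s with rfl | rfl <;> ext <;> simp
  right_inv p := by rcases Int.units_eq_one_or s with rfl | rfl <;> ext <;> simp <;> ring
  continuous_toFun := by fun_prop
  continuous_invFun := by fun_prop

theorem stretch_apply (a b : ℝ) (s : ℤˣ) (x y : ℝ) :
    stretch a b s (x, y) = (2 * x + a, (s : ℤ) * y + b) := rfl

/-- The frame of a window is locally the same as the frame of the opening under an arch. -/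
theorem planarFlat_sdiff_window {x y : ℝ} (hi : i < n)
    (hT : ∀ x y : ℝ, 0 < x → x < 3 → 3 / 2 < y → y < 5 / 2 →
      PlanarFlat (fingers n ∪ arch 0 1) (x, y))
    (hx : 2 * i < x) (hx' : x < 2 * i + 1) (hy : 0 < y) (hy' : y < 1) :
    PlanarFlat (fingers n \ window i) (x, y) := by
  -- The stretch takes the columns of the window to 1 < x < 2, the opening under the arch. Its lower
  -- edge y = 1/4 goes to the ceiling y = 2 by y ↦ 9/4 - y, and its upper edge y = 3/4 by y ↦ y +
  -- 5/4. Each half of the frame is thus matched with the same ceiling, at heights where no finger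
  -- interferes.
  rcases lt_or_ge y (3 / 5) with hy2 | hy2
  · refine PlanarFlat.congr (PlanarFlat.preimage (P := fingers n ∪ arch 0 1)
      (ψ := stretch (1 / 2 - 4 * i) (9 / 4) (-1)) ?_) ?_
    · rw [stretch_apply]
      refine hT _ _ ?_ ?_ ?_ ?_ <;> push_cast <;> linarith
    · have h1 : ∀ᶠ q : ℝ × ℝ in 𝓝 (x, y), (2 * i < q.1 ∧ q.1 < 2 * i + 1) ∧ 0 < q.2 ∧ q.2 < 3 / 5 :=
        (((isOpen_lt continuous_const continuous_fst).inter
          (isOpen_lt continuous_fst continuous_const)).inter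
          ((isOpen_lt continuous_const continuous_snd).inter
          (isOpen_lt continuous_snd continuous_const))).mem_nhds ⟨⟨hx, hx'⟩, hy, hy2⟩
      filter_upwards [h1]
      rintro ⟨u, v⟩ ⟨⟨h1, h2⟩, h3, h4⟩
      simp only at h1 h2 h3 h4
      have h5 : (u, v) ∈ fingers n := mem_fingers_of_mem hi h1.le h2.le (by linarith)
      rw [Set.mem_preimage, stretch_apply, Set.mem_union, Set.mem_sdiff, mem_window, mem_arch]
      have h6 : (2 * u + (1 / 2 - 4 * i), ((-1 : ℤˣ) : ℤ) * v + 9 / 4) ∉ fingers n := fun h => by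
        have := snd_le_of_mem_fingers h
        push_cast at this
        linarith
      simp only [h5, h6, true_and, false_or]
      push_cast
      grind
  · refine PlanarFlat.congr (PlanarFlat.preimage (P := fingers n ∪ arch 0 1)
      (ψ := stretch (1 / 2 - 4 * i) (5 / 4) 1) ?_) ?_
    · rw [stretch_apply]
      refine hT _ _ ?_ ?_ ?_ ?_ <;> push_cast <;> linarith
    · have h1 : ∀ᶠ q : ℝ × ℝ in 𝓝 (x, y), (2 * i < q.1 ∧ q.1 < 2 * i + 1) ∧ 1 / 2 < q.2 ∧ q.2 < 1 :=
        (((isOpen_lt continuous_const continuous_fst).inter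
          (isOpen_lt continuous_fst continuous_const)).inter
          ((isOpen_lt continuous_const continuous_snd).inter
          (isOpen_lt continuous_snd continuous_const))).mem_nhds
            ⟨⟨hx, hx'⟩, show 1 / 2 < y by linarith, hy'⟩
      filter_upwards [h1]
      rintro ⟨u, v⟩ ⟨⟨h1, h2⟩, h3, h4⟩
      simp only at h1 h2 h3 h4
      have h5 : (u, v) ∈ fingers n := mem_fingers_of_mem hi h1.le h2.le (by linarith)
      rw [Set.mem_preimage, stretch_apply, Set.mem_union, Set.mem_sdiff, mem_window, mem_arch]
      have h6 : (2 * u + (1 / 2 - 4 * i), ((1 : ℤˣ) : ℤ) * v + 5 / 4) ∉ fingers n := fun h => by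
        have := snd_le_of_mem_fingers h
        push_cast at this
        linarith
      simp only [h5, h6, true_and, false_or]
      push_cast
      grind

/-- If two of the disks can be tubed, then handles can be added to all disks. -/
theorem Cobordism.HasDisks.exists_isHandling (hC : C.HasDisks φ n) (hn : 2 ≤ n)
    (hT : C.IsTubing φ n 0 1 C') (hi : i < n) : ∃ H, C.IsHandling φ n i H := by
  have hn' : (2 : ℝ) ≤ n := by exact_mod_cast hn
  have hin : (i : ℝ) + 1 ≤ n := by exact_mod_cast hi
  have hi0 : (0 : ℝ) ≤ i := i.cast_nonneg
  have hT' : ∀ x y : ℝ, 0 < x → x < 3 → 3 / 2 < y → y < 5 / 2 →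
      PlanarFlat (fingers n ∪ arch 0 1) (x, y) := fun x y h1 h2 h3 h4 =>
    Cobordism.IsReplacement.planarFlat hT hC.1
      ⟨⟨by linarith, show x < 2 * n by linarith⟩, by linarith, by linarith⟩
  refine hC.exists_isReplacement (fun p hp => eventually_mem_sdiff_window fun h => hp ?_)
    fun p hp => ?_
  · obtain ⟨⟨h1, h2⟩, h3, h4⟩ := h
    exact ⟨⟨by linarith, by linarith⟩, by linarith, by linarith⟩
  · by_cases h : (2 * i + 1 / 4 ≤ p.1 ∧ p.1 ≤ 2 * i + 3 / 4) ∧ 1 / 4 ≤ p.2 ∧ p.2 ≤ 3 / 4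
    · obtain ⟨⟨h1, h2⟩, h3, h4⟩ := h
      exact planarFlat_sdiff_window hi hT' (by linarith) (by linarith) (by linarith) (by linarith)
    · refine (hC.planarFlat hp).congr ?_
      filter_upwards [eventually_mem_sdiff_window h] with q hq using hq.symm

/-- The tubes from site `0` to site `2` and from site `1` to site `3` can be pasted to a tube from
site `0` to site `3`. -/
theorem Cobordism.HasDisks.exists_isTubing_zero_three {C02 C13 : Cobordism O O'}
    (hC : C.HasDisks φ 4) (h02 : C.IsTubing φ 4 0 2 C02) (h13 : C.IsTubing φ 4 1 3 C13) :
    ∃ C', C.IsTubing φ 4 0 3 C' := by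
  -- The long arch agrees with the first short one for x < 4 and with the second for x > 3; these
  -- ranges overlap, so flatness holds everywhere.
  have hleft : ∀ p : ℝ × ℝ, p.1 < 4 →
      ∀ᶠ q in 𝓝 p, q ∈ fingers 4 ∪ arch 0 2 ↔ q ∈ fingers 4 ∪ arch 0 3 := fun p hp => by
    filter_upwards [(isOpen_lt continuous_fst continuous_const).mem_nhds hp]
    rintro ⟨x, y⟩ (hx : x < 4)
    rw [Set.mem_union, Set.mem_union, mem_arch, mem_arch, mem_fingers_four]
    push_cast
    grind
  have hright : ∀ p : ℝ × ℝ, 3 < p.1 →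
      ∀ᶠ q in 𝓝 p, q ∈ fingers 4 ∪ arch 1 3 ↔ q ∈ fingers 4 ∪ arch 0 3 := fun p hp => by
    filter_upwards [(isOpen_lt continuous_const continuous_fst).mem_nhds hp]
    rintro ⟨x, y⟩ (hx : 3 < x)
    rw [Set.mem_union, Set.mem_union, mem_arch, mem_arch, mem_fingers_four]
    push_cast
    grind
  refine hC.exists_isReplacement (fun p hp => ?_) fun p hp => ?_
  · have h : p.1 < 0 ∨ 7 < p.1 ∨ p.2 < 1 ∨ 3 < p.2 := by
      by_contra! h
      exact hp ⟨⟨by linarith, by push_cast; linarith⟩, by linarith, by linarith⟩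
    have h1 : IsOpen {p : ℝ × ℝ | p.1 < 0 ∨ 7 < p.1 ∨ p.2 < 1 ∨ 3 < p.2} :=
      (isOpen_lt continuous_fst continuous_const).union
        ((isOpen_lt continuous_const continuous_fst).union
        ((isOpen_lt continuous_snd continuous_const).union
        (isOpen_lt continuous_const continuous_snd)))
    filter_upwards [h1.mem_nhds h]
    rintro ⟨x, y⟩ hq
    simp only at hq
    rw [Set.mem_union, mem_arch, mem_fingers_four]
    push_cast
    grind
  · rcases lt_or_ge p.1 4 with h | h
    · exact (Cobordism.IsReplacement.planarFlat h02 hC.1 hp).congr (hleft p h)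
    · exact (Cobordism.IsReplacement.planarFlat h13 hC.1 hp).congr (hright p (by linarith))

end Existence

/-! ### Comparison of the relations. -/

section Relations

variable {B : Finset Circle} {O O' : Smoothing B} {C : Cobordism O O'}
  {φ : (ℝ × ℝ) × ℝ → Cylinder} {k : ℕ} (R : Type*) [Ring R]

/-- Splitting the last site in two: there is a chart in which the last disk is replaced by two
parallel pieces of it, which are connected outside of the new box. -/
theorem Cobordism.HasDisks.exists_split (hC : C.HasDisks φ (k + 1)) :
    ∃ φ', C.HasDisks φ' (k + 2) ∧
      (∀ i j T, i < j → j < k → C.IsTubing φ (k + 1) i j T → C.IsTubing φ' (k + 2) i j T) ∧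
      (∀ i T, i < k → C.IsTubing φ (k + 1) i k T →
        (∃ T', C.IsTubing φ' (k + 2) i k T' ∧ T'.toLinear R = T.toLinear R) ∧
        ∃ T', C.IsTubing φ' (k + 2) i (k + 1) T' ∧ T'.toLinear R = T.toLinear R) ∧
      (∀ i H, i < k → C.IsHandling φ (k + 1) i H → C.IsHandling φ' (k + 2) i H) ∧
      ∀ H, C.IsHandling φ (k + 1) k H →
        (∃ T', C.IsTubing φ' (k + 2) k (k + 1) T' ∧ T'.toLinear R = H.toLinear R) ∧
        (∃ H', C.IsHandling φ' (k + 2) k H' ∧ H'.toLinear R = H.toLinear R) ∧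
        ∃ H', C.IsHandling φ' (k + 2) (k + 1) H' ∧ H'.toLinear R = H.toLinear R := by
  obtain ⟨ψ, hψ⟩ := _root_.exists_split (2 * k)
  have hsub := isSubbox_split hψ
  -- a deformed picture, seen in the new chart
  have key : ∀ {P P' P'' : Set (ℝ × ℝ)} {T : Cobordism O O'},
      C.IsReplacement φ (k + 1) (thickSurface P) T → Deforms (k + 1) P' P →
      RestrictsTo (k + 1) (k + 2) {u | -1 / 4 < u.2} ψ P' P'' →
      ∃ T', C.IsReplacement (planarReparam φ ψ) (k + 2) (thickSurface P'') T' ∧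
        T'.toLinear R = T.toLinear R := fun {P P' P'' T} hT hP hP' => by
    obtain ⟨T', hT', h⟩ := hT.exists_of_deforms R hC.1 hP.symm
    exact ⟨T', hT'.reparam hC hsub hP', h⟩
  refine ⟨planarReparam φ ψ, hC.reparam hsub, fun i j T hij hj hT => ?_, fun i T hi hT => ⟨?_, ?_⟩,
    fun i H hi hH => ?_, fun H hH => ⟨?_, ?_, ?_⟩⟩
  · exact Cobordism.IsReplacement.reparam hT hC hsub (restrictsTo_split_arch hψ hij hj)
  · exact key hT (deforms_widen_right hi) (restrictsTo_split_arch_left hψ hi)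
  · exact key hT (deforms_widen_left hi) (restrictsTo_split_arch_right hψ hi)
  · exact Cobordism.IsReplacement.reparam hH hC hsub (restrictsTo_split_window hψ hi)
  -- The tube between the halves, pulled down into the finger, is a window over the middle third,
  -- which is then moved to the standard position.
  · exact key hH ((deforms_tallLoop (by linarith) (by linarith) (by linarith)).trans
      (deforms_hole (by linarith) (by linarith) (by linarith) (by linarith) (by linarith)
        (by linarith))) (restrictsTo_split_tallLoop hψ)
  · exact key hH (deforms_hole (by linarith) (by linarith) (by linarith) (by linarith)
      (by linarith) (by linarith)) (restrictsTo_split_hole_left hψ)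
  · exact key hH (deforms_hole (by linarith) (by linarith) (by linarith) (by linarith)
      (by linarith) (by linarith)) (restrictsTo_split_hole_right hψ)

/-- With only two sites, the first three-site relation is the neck-cutting relation. -/
theorem neckCutting_mem_threeSite₁ {T H0 H1 : Cobordism O O'} (hC : C.HasDisks φ 2)
    (hT : C.IsTubing φ 2 0 1 T) (h0 : C.IsHandling φ 2 0 H0) (h1 : C.IsHandling φ 2 1 H1) :
    H1.toLinear R + H0.toLinear R - (T.toLinear R + T.toLinear R) ∈ threeSite₁ R O O' := by
  -- Site 1 becomes the sites 1 and 2: both tubes from site 0 represent T, and the tube between the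
  -- halves represents H1.
  obtain ⟨φ', hC', -, hTub, hHan, hLast⟩ := hC.exists_split (k := 1) R
  obtain ⟨⟨Ta, hTa, eTa⟩, Tb, hTb, eTb⟩ := hTub 0 T zero_lt_one hT
  obtain ⟨⟨Tab, hTab, eTab⟩, -, -⟩ := hLast H1 h1
  exact ⟨φ', C, Tab, H0, Ta, Tb, hC', hTab, hHan 0 H0 zero_lt_one h0, hTa, hTb,
    by rw [eTa, eTb, eTab]⟩

/-- With only two sites, the second three-site relation is the neck-cutting relation. -/
theorem neckCutting_mem_threeSite₂ {T H0 H1 : Cobordism O O'} (hC : C.HasDisks φ 2)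
    (hT : C.IsTubing φ 2 0 1 T) (h0 : C.IsHandling φ 2 0 H0) (h1 : C.IsHandling φ 2 1 H1) :
    T.toLinear R + H1.toLinear R + T.toLinear R
      - (H0.toLinear R + H1.toLinear R + H1.toLinear R) ∈ threeSite₂ R O O' := by
  obtain ⟨φ', hC', -, hTub, hHan, hLast⟩ := hC.exists_split (k := 1) R
  obtain ⟨⟨Ta, hTa, eTa⟩, Tb, hTb, eTb⟩ := hTub 0 T zero_lt_one hT
  obtain ⟨⟨Tab, hTab, eTab⟩, ⟨Ha, hHa, eHa⟩, Hb, hHb, eHb⟩ := hLast H1 h1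
  exact ⟨φ', C, Ta, Tab, Tb, H0, Ha, Hb, hC', hTa, hTab, hTb, hHan 0 H0 zero_lt_one h0, hHa, hHb,
    by rw [eTa, eTb, eTab, eHa, eHb]⟩

/-- The neck-cutting relations at the last two of three sites. -/
theorem Cobordism.HasDisks.exists_lastTwo {T H1 H2 : Cobordism O O'} (hC : C.HasDisks φ 3)
    (hT : C.IsTubing φ 3 1 2 T) (h1 : C.IsHandling φ 3 1 H1) (h2 : C.IsHandling φ 3 2 H2) :
    ∃ φ', C.HasDisks φ' 2 ∧ C.IsTubing φ' 2 0 1 T ∧ C.IsHandling φ' 2 0 H1 ∧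
      C.IsHandling φ' 2 1 H2 := by
  obtain ⟨ψ, hψ, r1, r2, r3⟩ := _root_.exists_lastTwo
  exact ⟨planarReparam φ ψ, hC.reparam hψ, IsReplacement.reparam hT hC hψ r1,
    IsReplacement.reparam h1 hC hψ r2, IsReplacement.reparam h2 hC hψ r3⟩

variable (O O')

/-- A 3S₁ expression is a neck-cutting expression at the sites 1 and 2 minus a 3S₂ expression. The
handles at these two sites do not occur in 3S₁ and have to be constructed. -/
theorem threeSite₁_subset_span_threeSite₂ :
    threeSite₁ R O O' ⊆ Submodule.span R (threeSite₂ R O O') := by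
  rintro _ ⟨φ, C, T12, H0, T01, T02, hC, hT12, hH0, hT01, hT02, rfl⟩
  obtain ⟨H1, hH1⟩ := hC.exists_isHandling (i := 1) (by simp) hT01 (by simp)
  obtain ⟨H2, hH2⟩ := hC.exists_isHandling (i := 2) (by simp) hT01 (by simp)
  obtain ⟨φ', hC', hT, hH, hH'⟩ := hC.exists_lastTwo hT12 hH1 hH2
  have h1 := Submodule.subset_span (R := R) (neckCutting_mem_threeSite₂ R hC' hT hH hH')
  have h2 : _ ∈ Submodule.span R (threeSite₂ R O O') := Submodule.subset_span
    ⟨φ, C, T01, T12, T02, H0, H1, H2, hC, hT01, hT12, hT02, hH0, hH1, hH2, rfl⟩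
  rw [SetLike.mem_coe]
  convert Submodule.sub_mem _ h1 h2 using 1
  abel

theorem threeSite₂_subset_span_threeSite₁ :
    threeSite₂ R O O' ⊆ Submodule.span R (threeSite₁ R O O') := by
  rintro _ ⟨φ, C, T01, T12, T02, H0, H1, H2, hC, hT01, hT12, hT02, hH0, hH1, hH2, rfl⟩
  obtain ⟨φ', hC', hT, hH, hH'⟩ := hC.exists_lastTwo hT12 hH1 hH2
  have h1 := Submodule.subset_span (R := R) (neckCutting_mem_threeSite₁ R hC' hT hH hH')
  have h2 : _ ∈ Submodule.span R (threeSite₁ R O O') := Submodule.subset_span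
    ⟨φ, C, T12, H0, T01, T02, hC, hT12, hH0, hT01, hT02, rfl⟩
  rw [SetLike.mem_coe]
  convert Submodule.neg_mem _ (Submodule.add_mem _ h1 h2) using 1
  abel

/-- T23 + H0 = T02 + T03 and T13 + H0 = T01 + T03 differ by the four-tube relation; T03 and H0 are
auxiliary and have to be constructed. -/
theorem fourTube_subset_span_threeSite₁ :
    fourTube R O O' ⊆ Submodule.span R (threeSite₁ R O O') := by
  rintro _ ⟨φ, C, T01, T23, T02, T13, hC, hT01, hT23, hT02, hT13, rfl⟩
  obtain ⟨T03, hT03⟩ := hC.exists_isTubing_zero_three hT02 hT13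
  obtain ⟨H0, hH0⟩ := hC.exists_isHandling (i := 0) (by simp) hT01 (by simp)
  obtain ⟨ψ, hψ, r02, r03, r23, r0⟩ := exists_skip_one
  have h1 : _ ∈ Submodule.span R (threeSite₁ R O O') := Submodule.subset_span
    ⟨_, C, T23, H0, T02, T03, hC.reparam hψ, Cobordism.IsReplacement.reparam hT23 hC hψ r23,
      Cobordism.IsReplacement.reparam hH0 hC hψ r0,
      Cobordism.IsReplacement.reparam hT02 hC hψ r02,
      Cobordism.IsReplacement.reparam hT03 hC hψ r03, rfl⟩
  obtain ⟨ψ', hψ', s01, s03, s13, s0⟩ := exists_skip_two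
  have h2 : _ ∈ Submodule.span R (threeSite₁ R O O') := Submodule.subset_span
    ⟨_, C, T13, H0, T01, T03, hC.reparam hψ', Cobordism.IsReplacement.reparam hT13 hC hψ' s13,
      Cobordism.IsReplacement.reparam hH0 hC hψ' s0,
      Cobordism.IsReplacement.reparam hT01 hC hψ' s01,
      Cobordism.IsReplacement.reparam hT03 hC hψ' s03, rfl⟩
  rw [SetLike.mem_coe]
  convert Submodule.sub_mem _ h1 h2 using 1
  abel

theorem threeSite₁_subset_fourTube : threeSite₁ R O O' ⊆ fourTube R O O' := by
  rintro _ ⟨φ, C, T12, H0, T01, T02, hC, hT12, hH0, hT01, hT02, rfl⟩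
  -- The distinguished site of 3S₁ is the first one, whereas the last one is split, so the order of
  -- the sites is reversed beforehand. The halves become the sites 2 and 3, and the tube between
  -- them is H0.
  obtain ⟨φ', hC', hT, hTub, -, hLast⟩ :=
    (hC.reparam isSubbox_reflection).exists_split (k := 2) R
  obtain ⟨⟨Ta, hTa, eTa⟩, -⟩ := hTub 0 T02 zero_lt_two
    (Cobordism.IsReplacement.reparam hT02 hC isSubbox_reflection
      restrictsTo_reflection_arch_zero_two)
  obtain ⟨-, Tb, hTb, eTb⟩ := hTub 1 T01 one_lt_two
    (Cobordism.IsReplacement.reparam hT01 hC isSubbox_reflection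
      restrictsTo_reflection_arch_zero_one)
  obtain ⟨⟨Tab, hTab, eTab⟩, -⟩ := hLast H0
    (Cobordism.IsReplacement.reparam hH0 hC isSubbox_reflection
      restrictsTo_reflection_window_zero)
  have hT' := hT 0 1 T12 zero_lt_one one_lt_two
    (Cobordism.IsReplacement.reparam hT12 hC isSubbox_reflection
      restrictsTo_reflection_arch_one_two)
  refine ⟨φ', C, T12, Tab, Ta, Tb, hC', hT', hTab, hTa, hTb, ?_⟩
  rw [eTa, eTb, eTab, add_comm (T02.toLinear R)]

end Relations

theorem mainTheorem11 (R : Type*) [Ring R] (B : Finset Circle) (O O' : Smoothing B) :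
    Submodule.span R (threeSite₁ R O O') = Submodule.span R (threeSite₂ R O O') ∧
      Submodule.span R (threeSite₁ R O O') = Submodule.span R (fourTube R O O') ∧
      Submodule.span R (threeSite₂ R O O') = Submodule.span R (fourTube R O O') := by
  have h1 : Submodule.span R (threeSite₁ R O O') = Submodule.span R (threeSite₂ R O O') :=
    le_antisymm (Submodule.span_le.2 (threeSite₁_subset_span_threeSite₂ O O' R))
      (Submodule.span_le.2 (threeSite₂_subset_span_threeSite₁ O O' R))
  have h2 : Submodule.span R (threeSite₁ R O O') = Submodule.span R (fourTube R O O') :=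
    le_antisymm (Submodule.span_mono (threeSite₁_subset_fourTube O O' R))
      (Submodule.span_le.2 (fourTube_subset_span_threeSite₁ O O' R))
  exact ⟨h1, h2, h1 ▸ h2⟩
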